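/- Let $n\ge 0$ be an integer, $\alpha>0$, $\beta\in\mathbb R$, and let $\rho_{\rm post}:\mathbb R^n\to(0,\infty)$ be a probability density such that $\log\rho_{\rm post}$ is twice differentiable and $$\alpha I\preceq -\nabla_\theta\nabla_\theta\log\rho_{\rm post}(\theta)\preceq \beta I\qquad\text{for all }\theta\in\mathbb R^n .$$ For $a=(m,C)$ with $m\in\mathbb R^n$ and $C\in\mathbb R^{n\times n}$ symmetric positive definite, let $\rho_a=\mathcal N(m,C)$. Then $\mathrm{KL}[\rho_a\Vert\rho_{\rm post}]<\infty$ for every such $a$, and there is a unique $a_\star=(m_\star,C_\star)$, $C_\star\succ0$, that minimizes $\mathrm{KL}[\rho_a\Vert\rho_{\rm post}]$ over all such $a$. Let $a_t=(m_t,C_t)$, $0\le t\le T$, with $C_t\succ 0$, be a (classical) solution of one of the following three systems, with $\lambda_{0,\min}I\preceq C_0\preceq\lambda_{0,\max}I$, $\lambda_{0,\min},\lambda_{0,\max}\in\mathbb R$, and let $K$ be the corresponding constant: * Euclidean Gaussian gradient flow: $\ \dot m_t=\mathbb E_{\rho_{a_t}}[\nabla_\theta\log\rho_{\rm post}]$,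 $\ \dot C_t=\tfrac12C_t^{-1}+\tfrac12\mathbb E_{\rho_{a_t}}[\nabla_\theta\nabla_\theta\log\rho_{\rm post}]$, with $K=2\alpha/\max\{1,4/\alpha,4\lambda_{0,\max}\}$; * Gaussian Fisher–Rao gradient flow: $\ \dot m_t=C_t\,\mathbb E_{\rho_{a_t}}[\nabla_\theta\log\rho_{\rm post}]$, $\ \dot C_t=C_t+C_t\,\mathbb E_{\rho_{a_t}}[\nabla_\theta\nabla_\theta\log\rho_{\rm post}]\,C_t$, with $K=\alpha\min\{1/\beta,\lambda_{0,\min}\}$; * Gaussian Wasserstein gradient flow: $\ \dot m_t=\mathbb E_{\rho_{a_t}}[\nabla_\theta\log\rho_{\rm post}]$, $\ \dot C_t=2I+\mathbb E_{\rho_{a_t}}[\nabla_\theta\nabla_\theta\log\rho_{\rm post}]\,C_t+C_t\,\mathbb E_{\rho_{a_t}}[\nabla_\theta\nabla_\theta\log\rho_{\rm post}]$, with $K=2\alpha$. Then for all $t\in[0,T]$ $$\mathrm{KL}[\rho_{a_t}\Vert\rho_{\rm post}]\le e^{-Kt}\,\mathrm{KL}[\rho_{a_0}\Vert\rho_{\rm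 post}]+(1-e^{-Kt})\,\mathrm{KL}[\rho_{a_\star}\Vert\rho_{\rm post}]$$ and, with $W_2$ the quadratic Wasserstein distance, $$W_2^2(\rho_{a_t},\rho_{a_\star})\le\frac{2e^{-Kt}}{\alpha}\bigl(\mathrm{KL}[\rho_{a_0}\Vert\rho_{\rm post}]-\mathrm{KL}[\rho_{a_\star}\Vert\rho_{\rm post}]\bigr).$$ Since $T$ is arbitrary, both bounds hold for all $t\ge0$ along solutions defined on $[0,\infty)$. (For $n=0$ all divergences and distances vanish, and $1/\beta$ is read as $0$ when $\beta=0$; for $n\ge1$ one has $\beta\ge\alpha>0$.) -/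

import Mathlib

open MeasureTheory ProbabilityTheory InformationTheory Set
open scoped ENNReal Matrix

namespace GaussianVI

noncomputable section

/-- The state space `ℝⁿ` with the Euclidean norm. -/
abbrev E (n : ℕ) : Type := EuclideanSpace ℝ (Fin n)

/-- Real `n × n` matrices. -/
abbrev Mat (n : ℕ) : Type := Matrix (Fin n) (Fin n) ℝ

variable {n : ℕ}

/-- A strictly positive probability density with respect to Lebesgue measure on `ℝⁿ`.
(The Bochner integral of a non-integrable function is `0`, so the second field contains
integrability.) -/
structure IsPosDensity (ρ : E n → ℝ) : Prop where
  pos : ∀ θ, 0 < ρ θ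
  integral_eq_one : ∫ θ, ρ θ = 1

/-- The measure on `ℝⁿ` with Lebesgue density `ρ`. -/
def law (ρ : E n → ℝ) : Measure (E n) :=
  volume.withDensity fun θ => ENNReal.ofReal (ρ θ)

/-- The function `θ ↦ log ρ(θ)`. -/
def logDensity (ρ : E n → ℝ) : E n → ℝ := fun θ => Real.log (ρ θ)

/-- `f` is twice (Fréchet) differentiable on `ℝⁿ`. -/
def TwiceDifferentiable (f : E n → ℝ) : Prop :=
  Differentiable ℝ f ∧ Differentiable ℝ (fderiv ℝ f)

/-- The Hessian matrix `∂ᵢ∂ⱼ f(θ)`. -/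
def hessian (f : E n → ℝ) (θ : E n) : Mat n :=
  Matrix.of fun i j =>
    fderiv ℝ (fderiv ℝ f) θ (EuclideanSpace.single i 1) (EuclideanSpace.single j 1)

/-- The order on symmetric matrices: `B - A` is positive semidefinite. -/
def LoewnerLE (A B : Mat n) : Prop := (B - A).PosSemidef

/-- `ρ` is `α`-strongly logconcave: `log ρ` is twice differentiable and
`- ∇∇ log ρ(θ) ⪰ α I` for all `θ`. -/
def StronglyLogConcave (α : ℝ) (ρ : E n → ℝ) : Prop :=
  TwiceDifferentiable (logDensity ρ) ∧
    ∀ θ, LoewnerLE (α • (1 : Mat n)) (-hessian (logDensity ρ) θ)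

/-- `KL[N(m, C) ‖ ρ]`, with values in `[0, ∞]`. -/
def gaussKL (ρ : E n → ℝ) (m : E n) (C : Mat n) : ℝ≥0∞ :=
  klDiv (multivariateGaussian m C) (law ρ)

/-- `(m, C)`, with `C ≻ 0`, is a global minimizer of `KL[· ‖ ρ]` over all Gaussian densities. -/
def IsGaussKLMinimizer (ρ : E n → ℝ) (m : E n) (C : Mat n) : Prop :=
  C.PosDef ∧ ∀ (m' : E n) (C' : Mat n), C'.PosDef → gaussKL ρ m C ≤ gaussKL ρ m' C'

/-- The quadratic Wasserstein distance: the square root of the infimum of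
`∫ ‖x - y‖² dγ(x, y)` over all couplings `γ` of `μ` and `ν`. -/
def W2 (μ ν : Measure (E n)) : ℝ≥0∞ :=
  (⨅ (γ : Measure (E n × E n)) (_ : γ.map Prod.fst = μ ∧ γ.map Prod.snd = ν),
    ∫⁻ p, ENNReal.ofReal (‖p.1 - p.2‖ ^ 2) ∂γ) ^ (1 / 2 : ℝ)

/-- `𝔼_{N(m, C)} [∇ log ρ]`. -/
def meanScore (ρ : E n → ℝ) (m : E n) (C : Mat n) : E n :=
  ∫ θ, gradient (logDensity ρ) θ ∂(multivariateGaussian m C)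

/-- `𝔼_{N(m, C)} [∇∇ log ρ]`, entry by entry. -/
def meanHessian (ρ : E n → ℝ) (m : E n) (C : Mat n) : Mat n :=
  Matrix.of fun i j => ∫ θ, hessian (logDensity ρ) θ i j ∂(multivariateGaussian m C)

/-- `t ↦ (m t, C t)` is a curve on `[0, T]` with `C t ≻ 0` that solves
`dm/dt = u(m, C)`, `dC/dt = S(m, C)` (one-sided derivatives at the end points). -/
structure IsSolution (u : E n → Mat n → E n) (S : E n → Mat n → Mat n) (T : ℝ)
    (m : ℝ → E n) (C : ℝ → Mat n) : Prop where
  posDef : ∀ t ∈ Icc 0 T, (C t).PosDef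
  mean : ∀ t ∈ Icc 0 T, HasDerivWithinAt m (u (m t) (C t)) (Icc 0 T) t
  cov : ∀ t ∈ Icc 0 T, ∀ i j,
    HasDerivWithinAt (fun s => C s i j) (S (m t) (C t) i j) (Icc 0 T) t

/-- The Gaussian approximate gradient flow for the Euclidean metric on `(m, C)`:
`dm/dt = 𝔼[∇ log ρ]`, `dC/dt = ½ C⁻¹ + ½ 𝔼[∇∇ log ρ]`. -/
def IsEuclideanFlow (ρ : E n → ℝ) (T : ℝ) (m : ℝ → E n) (C : ℝ → Mat n) : Prop :=
  IsSolution (fun m C => meanScore ρ m C)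
    (fun m C => (1 / 2 : ℝ) • C⁻¹ + (1 / 2 : ℝ) • meanHessian ρ m C) T m C

/-- The Gaussian approximate Fisher–Rao gradient flow:
`dm/dt = C 𝔼[∇ log ρ]`, `dC/dt = C + C 𝔼[∇∇ log ρ] C`. -/
def IsFisherRaoFlow (ρ : E n → ℝ) (T : ℝ) (m : ℝ → E n) (C : ℝ → Mat n) : Prop :=
  IsSolution (fun m C => WithLp.toLp 2 (C *ᵥ (meanScore ρ m C).ofLp))
    (fun m C => C + C * meanHessian ρ m C * C) T m C

/-- The Gaussian approximate Wasserstein gradient flow: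
`dm/dt = 𝔼[∇ log ρ]`, `dC/dt = 2 I + 𝔼[∇∇ log ρ] C + C 𝔼[∇∇ log ρ]`. -/
def IsWassersteinFlow (ρ : E n → ℝ) (T : ℝ) (m : ℝ → E n) (C : ℝ → Mat n) : Prop :=
  IsSolution (fun m C => meanScore ρ m C)
    (fun m C => (2 : ℝ) • (1 : Mat n) + meanHessian ρ m C * C + C * meanHessian ρ m C) T m C

/-- The two convergence bounds with rate `K` on `[0, T]` along the curve `(m t, C t)`, in KL
divergence and in Wasserstein distance to `N(mstar, Cstar)`. -/
def ConvergesWithRate (ρ : E n → ℝ) (α K T : ℝ) (m : ℝ → E n) (C : ℝ → Mat n)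
    (mstar : E n) (Cstar : Mat n) : Prop :=
  ∀ t ∈ Icc 0 T,
    (gaussKL ρ (m t) (C t)).toReal
        ≤ Real.exp (-K * t) * (gaussKL ρ (m 0) (C 0)).toReal
          + (1 - Real.exp (-K * t)) * (gaussKL ρ mstar Cstar).toReal ∧
    W2 (multivariateGaussian (m t) (C t)) (multivariateGaussian mstar Cstar) ^ 2
        ≤ ENNReal.ofReal (2 * Real.exp (-K * t) / α *
            ((gaussKL ρ (m 0) (C 0)).toReal - (gaussKL ρ mstar Cstar).toReal))

end

end GaussianVI

namespace GaussianVI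

noncomputable section

open scoped MatrixOrder

variable {n : ℕ}

/-! ### Trace and determinant inequalities for positive definite matrices. -/

section LinearAlgebra

/-! Write `N(m, L Lᵀ)` as the image of the standard Gaussian under `z ↦ m + L z`. Then `KL = const -
G(m, L) - log |det L|` with `G = meanLog`, the mean of `log ρ(m + L z)`. Integrating the pointwise
Taylor bounds for `log ρ` along `d + B z` shows that `G` is `α`-strongly concave and has a matching
lower bound with `β`; Gaussian integration by parts (`integral_fderiv_op`) identifies the linear
term through the mean gradient `s` and the mean Hessian `H`. Two Gaussians are compared by factors
`R = √C` and `R (1 + K)` with `1 + K` positive definite, and `log det (1 + K) ≤ tr K` controls the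
entropy. The result is the convexity inequality `gaussKL_toReal_ge`, with `S = H + C⁻¹` as
covariance gradient.

Completing squares in it gives the Polyak–Łojasiewicz inequality `2α (KL - KL⋆) ≤ ‖s‖² + tr(S C S)`;
at a critical point it gives quadratic growth, hence uniqueness and the `W2` bound. A minimizer
exists because `|det L| exp G` is continuous, vanishes at singular `L` and decays at infinity.

Along a flow `(u, V)` the divergence decreases at rate `⟨s, u⟩ + ½ tr(S V)`. For the Wasserstein
flow this is exactly the right side of the inequality. For the Euclidean and Fisher–Rao flows it is
compared with that side by an upper, respectively lower, bound on `C t`, propagated by the matrix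
barrier `posSemidef_of_barrier`. Grönwall's argument then finishes the proof. -/

theorem posDef_sqrt {C : Mat n} (hC : C.PosDef) : (CFC.sqrt C).PosDef := by
  rw [← Matrix.isStrictlyPositive_iff_posDef] at hC ⊢
  exact hC.sqrt

theorem sqrt_mul_sqrt {C : Mat n} (hC : C.PosDef) : CFC.sqrt C * CFC.sqrt C = C := by
  exact CFC.sqrt_mul_sqrt_self C hC.posSemidef.nonneg

theorem transpose_of_isHermitian {A : Mat n} (hA : A.IsHermitian) : Aᵀ = A := by
  rw [← Matrix.conjTranspose_eq_transpose_of_trivial]; exact hA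

theorem posDef_conj {A B : Mat n} (hA : A.PosDef) (hB : B.det ≠ 0) : (B * A * Bᵀ).PosDef := by
  rw [← Matrix.conjTranspose_eq_transpose_of_trivial]
  apply hA.mul_mul_conjTranspose_same
  exact Matrix.vecMul_injective_of_isUnit ((Matrix.isUnit_iff_isUnit_det B).2 hB.isUnit)

theorem posDef_mul_transpose {L : Mat n} (hL : L.det ≠ 0) : (L * Lᵀ).PosDef := by
  simpa using posDef_conj (Matrix.PosDef.one) hL

/-- This is `log x ≤ x - 1` summed over the eigenvalues; every use of the concavity of the entropy
comes down to it. -/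
theorem log_det_le_trace_sub {P : Mat n} (hP : P.PosDef) : Real.log P.det ≤ P.trace - n := by
  rw [hP.isHermitian.det_eq_prod_eigenvalues, hP.isHermitian.trace_eq_sum_eigenvalues]
  simp only [RCLike.ofReal_real_eq_id, id_eq]
  rw [Real.log_prod (fun i _ => (hP.eigenvalues_pos i).ne')]
  calc _ ≤ ∑ i, (hP.isHermitian.eigenvalues i - 1) :=
        Finset.sum_le_sum fun i _ => Real.log_le_sub_one_of_pos (hP.eigenvalues_pos i)
    _ = _ := by simp

theorem trace_transpose_mul_self (A : Mat n) : (Aᵀ * A).trace = ∑ i, ∑ j, A i j ^ 2 := by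
  simp only [Matrix.trace, Matrix.diag, Matrix.mul_apply, Matrix.transpose_apply]
  rw [Finset.sum_comm]
  simp [pow_two]

theorem trace_transpose_mul_self_nonneg (A : Mat n) : 0 ≤ (Aᵀ * A).trace := by
  rw [trace_transpose_mul_self]; positivity

theorem eq_zero_of_trace_transpose_mul_self {A : Mat n} (h : (Aᵀ * A).trace = 0) : A = 0 := by
  rw [← Matrix.conjTranspose_eq_transpose_of_trivial] at h
  exact Matrix.trace_conjTranspose_mul_self_eq_zero_iff.1 h

theorem trace_conj_le {A M N : Mat n} (h : (N - M).PosSemidef) :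
    (Aᵀ * M * A).trace ≤ (Aᵀ * N * A).trace := by
  have := (h.conjTranspose_mul_mul_same A).trace_nonneg
  rw [Matrix.conjTranspose_eq_transpose_of_trivial, Matrix.mul_sub, Matrix.sub_mul,
    Matrix.trace_sub] at this
  linarith

/-- The tangent inequality of the concave function `log det` at `C`, from `log_det_le_trace_sub`
applied to `C^(-1/2) D C^(-1/2)`. -/
theorem log_det_sub_le {C D : Mat n} (hC : C.PosDef) (hD : D.PosDef) :
    Real.log D.det - Real.log C.det ≤ (C⁻¹ * (D - C)).trace := by
  set R := CFC.sqrt C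
  have hR : R.PosDef := posDef_sqrt hC
  have hRR : R * R = C := sqrt_mul_sqrt hC
  have hdet : R.det ≠ 0 := hR.det_pos.ne'
  have hRu : IsUnit R.det := hdet.isUnit
  have hiu : R⁻¹.det ≠ 0 := hR.inv.det_pos.ne'
  have hP : (R⁻¹ * D * R⁻¹).PosDef := by
    have := posDef_conj hD hiu
    rwa [transpose_of_isHermitian hR.inv.isHermitian] at this
  have h := log_det_le_trace_sub hP
  have h1 : (R⁻¹ * D * R⁻¹).trace = (C⁻¹ * D).trace := by
    rw [Matrix.trace_mul_comm, ← mul_assoc, ← hRR, Matrix.mul_inv_rev]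
  have h2 : (R⁻¹ * D * R⁻¹).det = D.det / C.det := by
    rw [← hRR, Matrix.det_mul, Matrix.det_mul, Matrix.det_mul, Matrix.det_nonsing_inv,
      Ring.inverse_eq_inv']
    field_simp
  rw [h1, h2, Real.log_div hD.det_pos.ne' hC.det_pos.ne'] at h
  rw [Matrix.mul_sub, Matrix.trace_sub, Matrix.nonsing_inv_mul _ hC.det_pos.ne'.isUnit]
  simpa using h

end LinearAlgebra

/-! ### Gaussian measures: affine images, moments, densities, integration by parts. -/

section Gaussian

/-- The action of a matrix on `ℝⁿ` as a continuous linear map. -/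
abbrev op (A : Mat n) : E n →L[ℝ] E n := Matrix.toEuclideanCLM (𝕜 := ℝ) A

/-- The standard Gaussian measure on `ℝⁿ`. -/
abbrev γ (n : ℕ) : Measure (E n) := stdGaussian (E n)

theorem adjoint_op (A : Mat n) : ContinuousLinearMap.adjoint (op A) = op Aᵀ := by
  rw [← ContinuousLinearMap.star_eq_adjoint, ← map_star, Matrix.star_eq_conjTranspose,
    Matrix.conjTranspose_eq_transpose_of_trivial]

theorem op_mul_apply (A B : Mat n) (z : E n) : op (A * B) z = op A (op B z) := by
  simp [op, map_mul]

theorem det_op (A : Mat n) : LinearMap.det (op A : E n →ₗ[ℝ] E n) = A.det := by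
  have : (op A : E n →ₗ[ℝ] E n) = Matrix.toLin (EuclideanSpace.basisFun (Fin n) ℝ).toBasis
      (EuclideanSpace.basisFun (Fin n) ℝ).toBasis A := by
    ext x i
    simp [op, Matrix.toLin_apply, Pi.single_apply]
    rfl
  rw [this, LinearMap.det_toLin]

/-- A Gaussian measure is determined by its mean and covariance. The factor `L` is arbitrary, not
the symmetric root; this freedom is used in all comparisons below. -/
theorem map_affine_stdGaussian (m : E n) (L : Mat n) :
    (γ n).map (fun z => m + op L z) = multivariateGaussian m (L * Lᵀ) := by
  have hL : (L * Lᵀ).PosSemidef := by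
    rw [← Matrix.conjTranspose_eq_transpose_of_trivial]
    exact Matrix.posSemidef_self_mul_conjTranspose L
  have h : (fun z => m + op L z) = (fun x => m + x) ∘ (op L) := rfl
  have hg : IsGaussian ((γ n).map (fun z => m + op L z)) := by
    rw [h, ← Measure.map_map (measurable_const_add m) (by fun_prop)]
    infer_instance
  apply IsGaussian.ext
  · rw [integral_map (by fun_prop) (by fun_prop)]
    simp only [id_eq, integral_id_multivariateGaussian]
    rw [integral_add (integrable_const _)
      (ContinuousLinearMap.integrable_comp _ IsGaussian.integrable_fun_id),
      ContinuousLinearMap.integral_comp_comm _ IsGaussian.integrable_fun_id]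
    simp
  · ext x y
    rw [covarianceBilin_multivariateGaussian hL, h,
      ← Measure.map_map (measurable_const_add m) (by fun_prop), covarianceBilin_map_const_add,
      covarianceBilin_map IsGaussian.memLp_two_id, covarianceBilin_stdGaussian,
      innerSL_apply_apply, ContinuousLinearMap.adjoint_inner_left, adjoint_op, ← op_mul_apply,
      Matrix.inner_toEuclideanCLM]

theorem integral_multivariateGaussian_mul_transpose {F : Type*} [NormedAddCommGroup F]
    [NormedSpace ℝ F] (m : E n) (L : Mat n) (f : E n → F) (hf : StronglyMeasurable f) :
    ∫ x, f x ∂(multivariateGaussian m (L * Lᵀ)) = ∫ z, f (m + op L z) ∂(γ n) := by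
  rw [← map_affine_stdGaussian, integral_map (by fun_prop) hf.aestronglyMeasurable]

theorem integrable_norm_pow_stdGaussian (k : ℕ) : Integrable (fun z : E n => ‖z‖ ^ k) (γ n) := by
  have h := IsGaussian.memLp_id (γ n) k (by simp)
  exact h.integrable_norm_pow'

theorem integrable_stdGaussian_of_norm_le {F : Type*} [NormedAddCommGroup F]
    {g : E n → F} (hg : AEStronglyMeasurable g (γ n)) (a b : ℝ)
    (h : ∀ z, ‖g z‖ ≤ a + b * ‖z‖ ^ 2) : Integrable g (γ n) :=
  Integrable.mono' ((integrable_const a).add ((integrable_norm_pow_stdGaussian 2).const_mul b)) hg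
    (Filter.Eventually.of_forall h)

theorem integral_norm_sq_affine (d : E n) (A : Mat n) :
    ∫ z, ‖d + op A z‖ ^ 2 ∂(γ n) = ‖d‖ ^ 2 + (Aᵀ * A).trace := by
  have hL : (A * Aᵀ).PosSemidef := by
    rw [← Matrix.conjTranspose_eq_transpose_of_trivial]
    exact Matrix.posSemidef_self_mul_conjTranspose A
  have hid : MemLp id 2 (multivariateGaussian d (A * Aᵀ)) := IsGaussian.memLp_two_id
  have hi : ∀ i, MemLp (fun x : E n => x i) 2 (multivariateGaussian d (A * Aᵀ)) := fun i =>
    (EuclideanSpace.proj i : E n →L[ℝ] ℝ).comp_memLp' hid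
  have hm : ∀ i, ∫ x : E n, x i ∂(multivariateGaussian d (A * Aᵀ)) = d i := fun i => by
    have := (EuclideanSpace.proj i : E n →L[ℝ] ℝ).integral_comp_comm
      (hid.integrable (by norm_num))
    simpa using this
  have hv : ∀ i, ∫ x : E n, x i ^ 2 ∂(multivariateGaussian d (A * Aᵀ))
      = d i ^ 2 + (A * Aᵀ) i i := fun i => by
    have h1 := variance_eval_multivariateGaussian (μ := d) hL i
    rw [variance_eq_sub (hi i), hm] at h1
    simp only [Pi.pow_apply] at h1
    linarith
  rw [← integral_multivariateGaussian_mul_transpose d A (fun x => ‖x‖ ^ 2)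
    (by fun_prop : Continuous fun x : E n => ‖x‖ ^ 2).stronglyMeasurable]
  simp_rw [EuclideanSpace.real_norm_sq_eq]
  rw [integral_finsetSum _ (fun i _ => (hi i).integrable_sq), Matrix.trace_mul_comm]
  simp_rw [hv, Finset.sum_add_distrib]
  rfl

/-- The density of the standard Gaussian measure. -/
def stdDensity (z : E n) : ℝ :=
  (Real.sqrt (2 * Real.pi) ^ n)⁻¹ * Real.exp (-(1 / 2) * ‖z‖ ^ 2)

theorem stdDensity_pos (z : E n) : 0 < stdDensity z := by
  unfold stdDensity; positivity

theorem continuous_stdDensity : Continuous (stdDensity (n := n)) := by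
  unfold stdDensity; fun_prop

theorem integrable_stdDensity : Integrable (stdDensity (n := n)) := by
  have := GaussianFourier.integrable_cexp_neg_mul_sq_norm_add (V := E n) (b := 1 / 2)
    (by norm_num) 0 0
  refine Integrable.const_mul ?_ _
  convert! this.norm using 2 with z
  rw [Complex.norm_exp]
  simp [← Complex.ofReal_pow]

/-- Both sides have the same characteristic function, by the Gaussian Fourier integral. -/
theorem stdGaussian_eq_withDensity :
    γ n = volume.withDensity (fun z => ENNReal.ofReal (stdDensity z)) := by
  have : IsFiniteMeasure (volume.withDensity (fun z : E n => ENNReal.ofReal (stdDensity z))) :=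
    isFiniteMeasure_withDensity_ofReal integrable_stdDensity.2
  apply Measure.ext_of_charFun
  ext t
  rw [charFun_stdGaussian, charFun_apply, integral_withDensity_eq_integral_toReal_smul
    (by have := continuous_stdDensity (n := n); fun_prop) (by simp)]
  have h := GaussianFourier.integral_cexp_neg_mul_sq_norm_add (V := E n) (b := 1 / 2)
    (by norm_num) Complex.I t
  have h2 : ∀ z : E n, (ENNReal.ofReal (stdDensity z)).toReal •
      Complex.exp ((inner ℝ z t : ℝ) * Complex.I) =
      (((Real.sqrt (2 * Real.pi) ^ n)⁻¹ : ℝ) : ℂ) *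
        Complex.exp (-(1 / 2) * (‖z‖ : ℂ) ^ 2 + Complex.I * (inner ℝ t z : ℝ)) := by
    intro z
    rw [ENNReal.toReal_ofReal (stdDensity_pos z).le, Complex.real_smul, stdDensity,
      Complex.ofReal_mul, Complex.ofReal_exp, mul_assoc, ← Complex.exp_add, real_inner_comm]
    congr 2
    push_cast
    ring
  simp_rw [h2]
  rw [integral_const_mul, h, ← mul_assoc]
  have h3 : ((Real.pi : ℂ) / (1 / 2)) ^ ((Module.finrank ℝ (E n) : ℂ) / 2)
      = ((Real.sqrt (2 * Real.pi) ^ n : ℝ) : ℂ) := by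
    rw [finrank_euclideanSpace_fin, Real.sqrt_eq_rpow, ← Real.rpow_natCast, ← Real.rpow_mul
      (by positivity), Complex.ofReal_cpow (by positivity)]
    congr 1
    · push_cast; ring
    · push_cast; ring
  rw [h3, ← Complex.ofReal_mul, inv_mul_cancel₀ (by positivity)]
  simp only [Complex.ofReal_one, Complex.I_sq, one_mul]
  congr 1
  ring

theorem map_equiv_withDensity {X Y : Type*} [MeasurableSpace X] [MeasurableSpace Y]
    (e : X ≃ᵐ Y) (μ : Measure X) (f : X → ℝ≥0∞) :
    (μ.withDensity f).map e = (μ.map e).withDensity (f ∘ e.symm) := by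
  ext s hs
  rw [e.map_apply, withDensity_apply _ (e.measurable hs), withDensity_apply _ hs,
    e.restrict_map, e.measurableEmbedding.lintegral_map]
  simp

/-- Stein's identity: integration by parts, since the derivative of the density along `v` is `-⟨v,
z⟩` times the density. -/
theorem integral_mul_inner_stdGaussian {g : E n → ℝ} (v : E n) (hg : Differentiable ℝ g)
    (h1 : Integrable g (γ n)) (h2 : Integrable (fun z => fderiv ℝ g z v) (γ n))
    (h3 : Integrable (fun z => g z * inner ℝ v z) (γ n)) :
    ∫ z, g z * inner ℝ v z ∂(γ n) = ∫ z, fderiv ℝ g z v ∂(γ n) := by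
  have hm : Measurable (fun z : E n => ENNReal.ofReal (stdDensity z)) := by
    have := continuous_stdDensity (n := n); fun_prop
  have hd : ∀ z : E n, HasFDerivAt stdDensity (-(stdDensity z) • innerSL ℝ z) z := by
    intro z
    have h := (((hasStrictFDerivAt_norm_sq z).hasFDerivAt.const_mul (-(1 / 2) : ℝ)).exp).const_mul
      (Real.sqrt (2 * Real.pi) ^ n)⁻¹
    refine h.congr_fderiv ?_
    ext w
    simp [stdDensity]
    ring
  have hdv : ∀ z : E n, fderiv ℝ stdDensity z v = -(stdDensity z * inner ℝ v z) := by
    intro z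
    rw [(hd z).fderiv]
    simp [real_inner_comm]
  rw [stdGaussian_eq_withDensity] at h1 h2 h3 ⊢
  rw [integrable_withDensity_iff_integrable_smul' hm (by simp)] at h1 h2 h3
  rw [integral_withDensity_eq_integral_toReal_smul hm (by simp),
    integral_withDensity_eq_integral_toReal_smul hm (by simp)]
  simp only [ENNReal.toReal_ofReal (stdDensity_pos _).le, smul_eq_mul] at h1 h2 h3 ⊢
  have key := integral_mul_fderiv_eq_neg_fderiv_mul_of_integrable (μ := volume) (f := g)
    (g := stdDensity (n := n)) (v := v) (by simpa [mul_comm] using h2)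
    (by
      simp_rw [hdv]
      convert! h3.neg using 2 with z
      simp; ring) (by simpa [mul_comm] using h1) (fun x _ => hg x)
    (fun x _ => (hd x).differentiableAt)
  simp_rw [hdv] at key
  have e1 : ∀ z, g z * -(stdDensity z * inner ℝ v z) = -(stdDensity z * (g z * inner ℝ v z)) :=
    fun z => by ring
  simp_rw [e1, integral_neg, neg_inj] at key
  rw [key]
  simp_rw [mul_comm]

/-- The density of the Gaussian measure with mean `m` and covariance `R Rᵀ`. -/
def gaussDensity (m : E n) (R : Mat n) (x : E n) : ℝ :=
  |R.det|⁻¹ * stdDensity (op R⁻¹ (x - m))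

theorem gaussDensity_pos (m : E n) {R : Mat n} (hR : R.det ≠ 0) (x : E n) :
    0 < gaussDensity m R x := by
  have := stdDensity_pos (op R⁻¹ (x - m))
  unfold gaussDensity; positivity

theorem continuous_gaussDensity (m : E n) (R : Mat n) : Continuous (gaussDensity m R) := by
  have := continuous_stdDensity (n := n)
  unfold gaussDensity; fun_prop

theorem multivariateGaussian_eq_withDensity (m : E n) {R : Mat n} (hR : R.det ≠ 0) :
    multivariateGaussian m (R * Rᵀ)
      = volume.withDensity (fun x => ENNReal.ofReal (gaussDensity m R x)) := by
  have e1 : ∀ z, op R⁻¹ (op R z) = z := fun z => by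
    rw [← op_mul_apply, Matrix.nonsing_inv_mul _ hR.isUnit]; simp
  have e2 : ∀ z, op R (op R⁻¹ z) = z := fun z => by
    rw [← op_mul_apply, Matrix.mul_nonsing_inv _ hR.isUnit]; simp
  let e : E n ≃ᵐ E n :=
    { toFun := fun z => m + op R z
      invFun := fun x => op R⁻¹ (x - m)
      left_inv := fun z => by simp [e1]
      right_inv := fun x => by simp [e2]
      measurable_toFun := by simp only [Equiv.coe_fn_mk]; fun_prop
      measurable_invFun := by simp only [Equiv.coe_fn_symm_mk]; fun_prop }
  have hvol : (volume : Measure (E n)).map e = ENNReal.ofReal |R.det|⁻¹ • volume := by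
    have h : (e : E n → E n) = (fun x => m + x) ∘ ((op R : E n →ₗ[ℝ] E n) : E n → E n) := rfl
    rw [h, ← Measure.map_map (measurable_const_add m)
        (show Measurable ((op R : E n →ₗ[ℝ] E n) : E n → E n) from (op R).continuous.measurable),
      Measure.map_linearMap_addHaar_eq_smul_addHaar _ (by rwa [det_op]), det_op,
      Measure.map_smul, map_add_left_eq_self, abs_inv]
  have : multivariateGaussian m (R * Rᵀ) = (γ n).map e := (map_affine_stdGaussian m R).symm
  rw [this, stdGaussian_eq_withDensity, map_equiv_withDensity, hvol, withDensity_smul_measure,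
    ← withDensity_smul _ (by
      have := continuous_stdDensity (n := n)
      have h2 := e.symm.measurable
      exact (this.measurable.comp h2).ennreal_ofReal)]
  congr 1
  ext x
  simp only [Pi.smul_apply, Function.comp_apply, smul_eq_mul, gaussDensity]
  rw [← ENNReal.ofReal_mul (by positivity)]
  rfl

end Gaussian

/-! ### Taylor bounds and growth of a function with pinched Hessian. -/

section Potential

/-- Since `h''` need not be continuous, no integral remainder is used: `h' - M t` decreases, hence
so does `h - h'(0) t - M t² / 2` on `[0, 1]`. -/
theorem taylor_le_of_deriv2_le {h h' h'' : ℝ → ℝ} {M : ℝ} (h1 : ∀ t, HasDerivAt h (h' t) t)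
    (h2 : ∀ t, HasDerivAt h' (h'' t) t) (hM : ∀ t, h'' t ≤ M) : h 1 ≤ h 0 + h' 0 + M / 2 := by
  have a1 : Antitone fun t => h' t - M * t :=
    antitone_of_hasDerivAt_nonpos
      (fun t => (h2 t).sub (((hasDerivAt_id t).const_mul M)))
      (fun t => by simpa using hM t)
  have d2 : ∀ t, HasDerivAt (fun t => h t - h' 0 * t - M / 2 * t ^ 2)
      (h' t - h' 0 * 1 - M / 2 * (2 * t)) t := fun t => by
    have := ((h1 t).sub ((hasDerivAt_id t).const_mul (h' 0))).sub
      ((hasDerivAt_pow 2 t).const_mul (M / 2))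
    simp only [mul_one] at this ⊢
    convert! this using 1
    norm_num
  have a2 : AntitoneOn (fun t => h t - h' 0 * t - M / 2 * t ^ 2) (Icc 0 1) := by
    apply antitoneOn_of_deriv_nonpos (convex_Icc 0 1)
    · exact fun t _ => (d2 t).continuousAt.continuousWithinAt
    · exact fun t _ => (d2 t).differentiableAt.differentiableWithinAt
    · intro t ht
      rw [interior_Icc] at ht
      rw [(d2 t).deriv]
      have := a1 ht.1.le
      simp only [mul_zero, sub_zero] at this
      linarith
  have := a2 (left_mem_Icc.2 zero_le_one) (right_mem_Icc.2 zero_le_one) zero_le_one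
  simp only [mul_one, one_pow, mul_zero] at this
  norm_num at this
  linarith

/-- `f` is twice differentiable with symmetric second derivative between `-β I` and `-α I`. -/
structure IsPinched (f : E n → ℝ) (α β : ℝ) : Prop where
  twice : TwiceDifferentiable f
  symm : ∀ x v w, fderiv ℝ (fderiv ℝ f) x v w = fderiv ℝ (fderiv ℝ f) x w v
  le_neg : ∀ x v, fderiv ℝ (fderiv ℝ f) x v v ≤ -α * ‖v‖ ^ 2
  neg_le : ∀ x v, -β * ‖v‖ ^ 2 ≤ fderiv ℝ (fderiv ℝ f) x v v

theorem bilinear_eq_sum (D : E n →L[ℝ] E n →L[ℝ] ℝ) (v w : E n) :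
    D v w = ∑ i, ∑ j, v i * w j *
      D (EuclideanSpace.single i 1) (EuclideanSpace.single j 1) := by
  have hs : ∀ u : E n, u = ∑ i, u i • EuclideanSpace.single i (1 : ℝ) := fun u => by
    simpa using ((EuclideanSpace.basisFun (Fin n) ℝ).sum_repr u).symm
  conv_lhs => rw [hs v, hs w]
  simp only [map_sum, map_smul, sum_apply, smul_apply,
    smul_eq_mul, Finset.mul_sum]
  rw [Finset.sum_comm]
  refine Finset.sum_congr rfl fun i _ => Finset.sum_congr rfl fun j _ => by ring

theorem fderiv_fderiv_eq (f : E n → ℝ) (x v w : E n) :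
    fderiv ℝ (fderiv ℝ f) x v w = v.ofLp ⬝ᵥ hessian f x *ᵥ w.ofLp := by
  rw [bilinear_eq_sum]
  simp only [dotProduct, Matrix.mulVec, hessian, Matrix.of_apply, Finset.mul_sum]
  refine Finset.sum_congr rfl fun i _ => Finset.sum_congr rfl fun j _ => by ring

theorem ofLp_dotProduct_self (v : E n) : v.ofLp ⬝ᵥ v.ofLp = ‖v‖ ^ 2 := by
  rw [EuclideanSpace.real_norm_sq_eq]
  simp [dotProduct, pow_two]

theorem isPinched_of_loewnerLE {f : E n → ℝ} {α β : ℝ} (hf : TwiceDifferentiable f)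
    (hα : ∀ θ, LoewnerLE (α • (1 : Mat n)) (-hessian f θ))
    (hβ : ∀ θ, LoewnerLE (-hessian f θ) (β • (1 : Mat n))) : IsPinched f α β where
  twice := hf
  symm x v w := by
    -- Symmetry is read off from `hα`, because `PosSemidef` contains it.
    have h1 : (hessian f x).IsHermitian := by
      have := (hα x).isHermitian
      have h2 : hessian f x = -((-hessian f x - α • (1 : Mat n)) + α • (1 : Mat n)) := by simp
      rw [h2]
      exact (this.add (by simp [Matrix.IsHermitian])).neg
    rw [fderiv_fderiv_eq, fderiv_fderiv_eq, Matrix.dotProduct_mulVec, ← Matrix.mulVec_transpose,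
      transpose_of_isHermitian h1, dotProduct_comm]
  le_neg x v := by
    have := (hα x).dotProduct_mulVec_nonneg v.ofLp
    rw [Matrix.sub_mulVec, dotProduct_sub, Matrix.neg_mulVec, dotProduct_neg,
      Matrix.smul_mulVec, Matrix.one_mulVec, dotProduct_smul, star_trivial,
      ofLp_dotProduct_self, ← fderiv_fderiv_eq, smul_eq_mul] at this
    linarith
  neg_le x v := by
    have := (hβ x).dotProduct_mulVec_nonneg v.ofLp
    rw [Matrix.sub_mulVec, dotProduct_sub, Matrix.neg_mulVec, dotProduct_neg,
      Matrix.smul_mulVec, Matrix.one_mulVec, dotProduct_smul, star_trivial,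
      ofLp_dotProduct_self, ← fderiv_fderiv_eq, smul_eq_mul] at this
    linarith

namespace IsPinched

variable {f : E n → ℝ} {α β : ℝ}

theorem hasDerivAt_line (hf : IsPinched f α β) (x v : E n) (t : ℝ) :
    HasDerivAt (fun t : ℝ => f (x + t • v)) (fderiv ℝ f (x + t • v) v) t := by
  have h1 : HasDerivAt (fun t : ℝ => x + t • v) v t := by
    simpa using ((hasDerivAt_id t).smul_const v).const_add x
  exact (hf.twice.1 _).hasFDerivAt.comp_hasDerivAt t h1

theorem hasDerivAt_fderiv_line (hf : IsPinched f α β) (x v w : E n) (t : ℝ) :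
    HasDerivAt (fun t : ℝ => fderiv ℝ f (x + t • v) w)
      (fderiv ℝ (fderiv ℝ f) (x + t • v) v w) t := by
  have h1 : HasDerivAt (fun t : ℝ => x + t • v) v t := by
    simpa using ((hasDerivAt_id t).smul_const v).const_add x
  exact ((hf.twice.2 _).hasFDerivAt.comp_hasDerivAt t h1).clm_apply (hasDerivAt_const t w)
    |>.congr_deriv (by simp)

theorem le_taylor (hf : IsPinched f α β) (x v : E n) :
    f (x + v) ≤ f x + fderiv ℝ f x v - α / 2 * ‖v‖ ^ 2 := by
  have := taylor_le_of_deriv2_le (hf.hasDerivAt_line x v) (hf.hasDerivAt_fderiv_line x v v)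
    (fun t => hf.le_neg _ v)
  simp only [one_smul, zero_smul, add_zero] at this
  linarith

theorem taylor_le (hf : IsPinched f α β) (x v : E n) :
    f x + fderiv ℝ f x v - β / 2 * ‖v‖ ^ 2 ≤ f (x + v) := by
  have := taylor_le_of_deriv2_le (fun t => (hf.hasDerivAt_line x v t).neg)
    (fun t => (hf.hasDerivAt_fderiv_line x v v t).neg)
    (M := β * ‖v‖ ^ 2) (fun t => by have := hf.neg_le (x + t • v) v; linarith)
  simp only [one_smul, zero_smul, add_zero, Pi.neg_apply] at this
  linarith

theorem exists_norm_fderiv_fderiv_le (hf : IsPinched f α β) :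
    ∃ Λ : ℝ, 0 ≤ Λ ∧ ∀ x, ‖fderiv ℝ (fderiv ℝ f) x‖ ≤ Λ := by
  set c : ℝ := |α| + |β| with hc
  have hc0 : 0 ≤ c := by positivity
  have hq : ∀ x v, |fderiv ℝ (fderiv ℝ f) x v v| ≤ c * ‖v‖ ^ 2 := fun x v => by
    have h1 := hf.le_neg x v
    have h2 := hf.neg_le x v
    have h3 : -α * ‖v‖ ^ 2 ≤ |α| * ‖v‖ ^ 2 := by gcongr; exact neg_le_abs α
    have h4 : β * ‖v‖ ^ 2 ≤ |β| * ‖v‖ ^ 2 := by gcongr; exact le_abs_self β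
    have h5 : 0 ≤ |α| * ‖v‖ ^ 2 := by positivity
    have h6 : 0 ≤ |β| * ‖v‖ ^ 2 := by positivity
    rw [abs_le, hc]
    constructor <;> linarith
  have he : ∀ x i j, |fderiv ℝ (fderiv ℝ f) x (EuclideanSpace.single i 1)
      (EuclideanSpace.single j 1)| ≤ 2 * c := fun x i j => by
    set D := fderiv ℝ (fderiv ℝ f) x
    set a : E n := EuclideanSpace.single i 1
    set b : E n := EuclideanSpace.single j 1
    -- Polarization turns the bound on the quadratic form into one on the entries; the parallelogram
    -- law would even give `c`, so the factor `2` is slack.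
    have e1 : D (a + b) (a + b) - D (a - b) (a - b) = 4 * D a b := by
      have := hf.symm x a b
      simp only [map_add, map_sub, add_apply, sub_apply]
      change D a b = D b a at this
      linarith
    have ha : ‖a‖ = 1 := by simp [a]
    have hb : ‖b‖ = 1 := by simp [b]
    have h1 := abs_le.1 (hq x (a + b))
    have h2 := abs_le.1 (hq x (a - b))
    have h3 : c * ‖a + b‖ ^ 2 + c * ‖a - b‖ ^ 2 = 4 * c := by
      have := parallelogram_law_with_norm ℝ a b
      rw [ha, hb] at this
      linear_combination c * this
    change (_ ≤ D (a + b) (a + b) ∧ _) at h1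
    change (_ ≤ D (a - b) (a - b) ∧ _) at h2
    rw [abs_le]
    constructor <;> linarith [h1.1, h1.2, h2.1, h2.2]
  refine ⟨∑ _i : Fin n, ∑ _j : Fin n, 2 * c, by positivity, fun x => ?_⟩
  refine ContinuousLinearMap.opNorm_le_bound₂ _ (by positivity) fun v w => ?_
  rw [bilinear_eq_sum, Finset.sum_mul, Finset.sum_mul]
  refine (norm_sum_le _ _).trans (Finset.sum_le_sum fun i _ => ?_)
  rw [Finset.sum_mul, Finset.sum_mul]
  refine (norm_sum_le _ _).trans (Finset.sum_le_sum fun j _ => ?_)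
  rw [norm_mul, norm_mul]
  have h1 := PiLp.norm_apply_le v i
  have h2 := PiLp.norm_apply_le w j
  calc _ ≤ ‖v‖ * ‖w‖ * (2 * c) := by gcongr; exact he x i j
    _ = _ := by ring

theorem exists_norm_fderiv_le (hf : IsPinched f α β) :
    ∃ a b : ℝ, 0 ≤ a ∧ 0 ≤ b ∧ ∀ x, ‖fderiv ℝ f x‖ ≤ a + b * ‖x‖ := by
  obtain ⟨Λ, hΛ, h⟩ := hf.exists_norm_fderiv_fderiv_le
  refine ⟨‖fderiv ℝ f 0‖, Λ, norm_nonneg _, hΛ, fun x => ?_⟩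
  have := convex_univ.norm_image_sub_le_of_norm_fderiv_le (𝕜 := ℝ) (f := fderiv ℝ f)
    (fun x _ => hf.twice.2 x) (fun x _ => h x) (mem_univ 0) (mem_univ x)
  rw [sub_zero] at this
  linarith [norm_le_norm_add_norm_sub' (fderiv ℝ f x) (fderiv ℝ f 0)]

theorem continuous (hf : IsPinched f α β) : Continuous f := hf.twice.1.continuous

theorem continuous_fderiv (hf : IsPinched f α β) : Continuous (fderiv ℝ f) :=
  hf.twice.2.continuous

theorem exists_abs_le (hf : IsPinched f α β) :
    ∃ a b : ℝ, 0 ≤ a ∧ 0 ≤ b ∧ ∀ x, |f x| ≤ a + b * ‖x‖ ^ 2 := by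
  set k := ‖fderiv ℝ f 0‖ with hk
  refine ⟨|f 0| + k, k + |α| + |β|, by positivity, by positivity, fun x => ?_⟩
  have h1 := hf.le_taylor 0 x
  have h2 := hf.taylor_le 0 x
  rw [zero_add] at h1 h2
  have h3 := abs_le.1 ((fderiv ℝ f 0).le_opNorm x)
  rw [← hk] at h3
  have h3a := h3.1
  have h3b := h3.2
  have h4 : k * ‖x‖ ≤ k + k * ‖x‖ ^ 2 := by
    nlinarith [norm_nonneg (fderiv ℝ f 0), sq_nonneg (‖x‖ - 1 / 2)]
  have h5 : -(α / 2) * ‖x‖ ^ 2 ≤ |α| * ‖x‖ ^ 2 := by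
    gcongr
    linarith [neg_le_abs α, abs_nonneg α]
  have h6 : β / 2 * ‖x‖ ^ 2 ≤ |β| * ‖x‖ ^ 2 := by
    gcongr
    linarith [le_abs_self β, abs_nonneg β]
  have h7 := abs_le.1 (le_refl |f 0|)
  have h8 : 0 ≤ |α| * ‖x‖ ^ 2 := by positivity
  have h9 : 0 ≤ |β| * ‖x‖ ^ 2 := by positivity
  rw [abs_le]
  constructor <;> linarith [h7.1, h7.2]

end IsPinched

end Potential

/-! ### Gaussian expectations of the potential as functions of `(m, L)`. -/

section Expectations

theorem op_apply_eq_sum (B : Mat n) (z : E n) :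
    op B z = ∑ i, ∑ j, (B i j * z j) • EuclideanSpace.single i (1 : ℝ) := by
  have hs : op B z = ∑ i, (op B z) i • EuclideanSpace.single i (1 : ℝ) := by
    simpa using ((EuclideanSpace.basisFun (Fin n) ℝ).sum_repr (op B z)).symm
  rw [hs]
  refine Finset.sum_congr rfl fun i _ => ?_
  rw [← Finset.sum_smul, Matrix.ofLp_toEuclideanCLM]
  rfl

theorem integrable_stdGaussian_of_norm_le_mul {F : Type*} [NormedAddCommGroup F]
    {g : E n → F} (hg : AEStronglyMeasurable g (γ n)) {p q r s : ℝ} (hp : 0 ≤ p) (hq : 0 ≤ q)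
    (hr : 0 ≤ r) (hs : 0 ≤ s)
    (h : ∀ z, ‖g z‖ ≤ (p + q * ‖z‖) * (r + s * ‖z‖)) : Integrable g (γ n) := by
  refine integrable_stdGaussian_of_norm_le hg (p * r + (p * s + q * r))
    (q * s + (p * s + q * r)) fun z => (h z).trans ?_
  have h1 : ‖z‖ ≤ 1 + ‖z‖ ^ 2 := by nlinarith [sq_nonneg (‖z‖ - 1 / 2)]
  have h2 : 0 ≤ p * s + q * r := by positivity
  nlinarith [mul_le_mul_of_nonneg_left h1 h2]

theorem norm_affine_le (m : E n) (L : Mat n) (z : E n) :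
    ‖m + op L z‖ ≤ ‖m‖ + ‖op L‖ * ‖z‖ :=
  (norm_add_le _ _).trans (by gcongr; exact (op L).le_opNorm z)

namespace IsPinched

variable {f : E n → ℝ} {α β : ℝ}

theorem integrable_affine (hf : IsPinched f α β) (m : E n) (L : Mat n) :
    Integrable (fun z => f (m + op L z)) (γ n) := by
  obtain ⟨a, b, ha, hb, h⟩ := hf.exists_abs_le
  have hc : Continuous fun z => f (m + op L z) := hf.continuous.comp (by fun_prop)
  refine integrable_stdGaussian_of_norm_le hc.aestronglyMeasurable (a + b * (2 * ‖m‖ ^ 2))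
    (b * (2 * ‖op L‖ ^ 2)) fun z => (h _).trans ?_
  have h1 := norm_affine_le m L z
  have h2 : ‖m + op L z‖ ^ 2 ≤ 2 * ‖m‖ ^ 2 + 2 * ‖op L‖ ^ 2 * ‖z‖ ^ 2 :=
    calc _ ≤ (‖m‖ + ‖op L‖ * ‖z‖) ^ 2 := by gcongr
      _ ≤ _ := by nlinarith [sq_nonneg (‖m‖ - ‖op L‖ * ‖z‖)]
  nlinarith [mul_le_mul_of_nonneg_left h2 hb]

theorem exists_norm_fderiv_affine_le (hf : IsPinched f α β) (m : E n) (L : Mat n) :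
    ∃ p q : ℝ, 0 ≤ p ∧ 0 ≤ q ∧ ∀ z, ‖fderiv ℝ f (m + op L z)‖ ≤ p + q * ‖z‖ := by
  obtain ⟨a, b, ha, hb, h⟩ := hf.exists_norm_fderiv_le
  refine ⟨a + b * ‖m‖, b * ‖op L‖, by positivity, by positivity, fun z => (h _).trans ?_⟩
  have h1 := norm_affine_le m L z
  nlinarith [mul_le_mul_of_nonneg_left h1 hb]

theorem integrable_fderiv_affine (hf : IsPinched f α β) (m : E n) (L : Mat n) (d : E n)
    (B : Mat n) : Integrable (fun z => fderiv ℝ f (m + op L z) (d + op B z)) (γ n) := by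
  obtain ⟨p, q, hp, hq, h⟩ := hf.exists_norm_fderiv_affine_le m L
  have hc : Continuous fun z => fderiv ℝ f (m + op L z) (d + op B z) :=
    (hf.continuous_fderiv.comp (by fun_prop : Continuous fun z => m + op L z)).clm_apply
      (by fun_prop)
  exact integrable_stdGaussian_of_norm_le_mul hc.aestronglyMeasurable hp hq (norm_nonneg d)
    (norm_nonneg (op B)) fun z => (ContinuousLinearMap.le_opNorm _ _).trans
      (mul_le_mul (h z) (norm_affine_le d B z) (norm_nonneg _) (by positivity))

theorem measurable_hessian (i j : Fin n) : Measurable fun x => hessian f x i j := by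
  simp only [hessian, Matrix.of_apply]
  exact ((measurable_fderiv ℝ (fderiv ℝ f)).apply_continuousLinearMap _).apply_continuousLinearMap _

theorem integrable_hessian (hf : IsPinched f α β) (μ : Measure (E n)) [IsFiniteMeasure μ]
    (i j : Fin n) : Integrable (fun x => hessian f x i j) μ := by
  obtain ⟨Λ, hΛ, h⟩ := hf.exists_norm_fderiv_fderiv_le
  refine Integrable.of_bound (measurable_hessian i j).aestronglyMeasurable Λ
    (Filter.Eventually.of_forall fun x => ?_)
  simp only [hessian, Matrix.of_apply]
  refine (ContinuousLinearMap.le_opNorm₂ _ _ _).trans ?_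
  simpa using h x

theorem gradient_eq_toDual_symm (f : E n → ℝ) :
    gradient f = fun x => (InnerProductSpace.toDual ℝ (E n)).symm (fderiv ℝ f x) := rfl

end IsPinched

variable {ρ : E n → ℝ} {α β : ℝ}

theorem meanHessian_mul_transpose (m : E n) (L : Mat n) (i j : Fin n) :
    meanHessian ρ m (L * Lᵀ) i j = ∫ z, hessian (logDensity ρ) (m + op L z) i j ∂(γ n) := by
  simp only [meanHessian, Matrix.of_apply]
  exact integral_multivariateGaussian_mul_transpose m L _
    (IsPinched.measurable_hessian i j).stronglyMeasurable

theorem inner_meanScore (hf : IsPinched (logDensity ρ) α β) (m : E n) (L : Mat n) (d : E n) :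
    inner ℝ (meanScore ρ m (L * Lᵀ)) d = ∫ z, fderiv ℝ (logDensity ρ) (m + op L z) d ∂(γ n) := by
  have hc : Continuous (gradient (logDensity ρ)) := by
    rw [IsPinched.gradient_eq_toDual_symm]
    exact (LinearIsometryEquiv.continuous _).comp hf.continuous_fderiv
  rw [meanScore, integral_multivariateGaussian_mul_transpose m L _ hc.stronglyMeasurable,
    real_inner_comm, ← integral_inner]
  · refine integral_congr_ae (Filter.Eventually.of_forall fun z => ?_)
    change inner ℝ d (gradient (logDensity ρ) (m + op L z)) = _
    rw [real_inner_comm, gradient, InnerProductSpace.toDual_symm_apply]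
  · obtain ⟨p, q, hp, hq, h⟩ := hf.exists_norm_fderiv_affine_le m L
    refine integrable_stdGaussian_of_norm_le_mul
      (hc.comp (by fun_prop : Continuous fun z => m + op L z)).aestronglyMeasurable
      hp hq zero_le_one le_rfl fun z => ?_
    simpa [gradient] using h z

/-- Stein's identity trades each factor `z j` for a derivative along the `j`-th column of `L`, which
brings in the Hessian; only boundedness and measurability of the Hessian are needed. -/
theorem integral_fderiv_op (hf : IsPinched (logDensity ρ) α β) (m : E n) (L B : Mat n) :
    ∫ z, fderiv ℝ (logDensity ρ) (m + op L z) (op B z) ∂(γ n)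
      = (Bᵀ * (meanHessian ρ m (L * Lᵀ)) * L).trace := by
  set f := logDensity ρ
  set H := meanHessian ρ m (L * Lᵀ) with hH
  obtain ⟨p, q, hp, hq, hpq⟩ := hf.exists_norm_fderiv_affine_le m L
  have hcont : Continuous fun z => fderiv ℝ f (m + op L z) :=
    hf.continuous_fderiv.comp (by fun_prop : Continuous fun z => m + op L z)
  have hd : ∀ i z, HasFDerivAt (fun z => fderiv ℝ f (m + op L z) (EuclideanSpace.single i 1))
      (((fderiv ℝ (fderiv ℝ f) (m + op L z)).flip (EuclideanSpace.single i 1)).comp (op L)) z := by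
    intro i z
    have h1 : HasFDerivAt (fun z => m + op L z) (op L) z := (op L).hasFDerivAt.const_add m
    have h2 := ((hf.twice.2 _).hasFDerivAt.comp z h1).clm_apply
      (hasFDerivAt_const (EuclideanSpace.single i (1 : ℝ)) z)
    refine h2.congr_fderiv ?_
    ext w
    simp
  have hi : ∀ i j z, fderiv ℝ (fun z => fderiv ℝ f (m + op L z) (EuclideanSpace.single i 1)) z
      (EuclideanSpace.single j 1) = ∑ k, L k j * hessian f (m + op L z) k i := by
    intro i j z
    rw [(hd i z).fderiv, ContinuousLinearMap.comp_apply, ContinuousLinearMap.flip_apply,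
      fderiv_fderiv_eq]
    simp [dotProduct, Matrix.mulVec_single, Matrix.ofLp_toEuclideanCLM]
  have hstein : ∀ i j, ∫ z, fderiv ℝ f (m + op L z) (EuclideanSpace.single i 1) * z j ∂(γ n)
      = ∑ k, L k j * H k i := by
    intro i j
    have hint : Integrable (fun z => ∑ k, L k j * hessian f (m + op L z) k i) (γ n) := by
      refine integrable_finsetSum _ fun k _ => Integrable.const_mul ?_ _
      have := hf.integrable_hessian ((γ n).map (fun z => m + op L z)) k i
      rwa [integrable_map_measure (IsPinched.measurable_hessian k i).aestronglyMeasurable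
        (by fun_prop)] at this
    have := integral_mul_inner_stdGaussian (EuclideanSpace.single j (1 : ℝ))
      (g := fun z => fderiv ℝ f (m + op L z) (EuclideanSpace.single i 1))
      (fun z => (hd i z).differentiableAt)
      (by simpa using hf.integrable_fderiv_affine m L (EuclideanSpace.single i 1) 0)
      (by simp_rw [hi]; exact hint)
      (integrable_stdGaussian_of_norm_le_mul
        ((hcont.clm_apply continuous_const).mul (by fun_prop)).aestronglyMeasurable hp hq
        le_rfl zero_le_one (fun z => by
          rw [norm_mul]
          refine mul_le_mul ?_ ?_ (norm_nonneg _) (by positivity)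
          · refine ((fderiv ℝ f (m + op L z)).le_opNorm _).trans ?_
            simpa using hpq z
          · refine (norm_inner_le_norm _ _).trans ?_
            simp))
    simp_rw [hi] at this
    simp only [EuclideanSpace.inner_single_left, map_one, one_mul] at this
    rw [this, integral_finsetSum]
    · refine Finset.sum_congr rfl fun k _ => ?_
      rw [integral_const_mul, hH, meanHessian_mul_transpose]
    · intro k _
      refine Integrable.const_mul ?_ _
      have := hf.integrable_hessian ((γ n).map (fun z => m + op L z)) k i
      rwa [integrable_map_measure (IsPinched.measurable_hessian k i).aestronglyMeasurable
        (by fun_prop)] at this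
  have hsym : ∀ k i, H k i = H i k := fun k i => by
    rw [hH, meanHessian_mul_transpose, meanHessian_mul_transpose]
    refine integral_congr_ae (Filter.Eventually.of_forall fun z => ?_)
    exact hf.symm _ _ _
  have hexp : ∀ z, fderiv ℝ f (m + op L z) (op B z) = ∑ i, ∑ j,
      B i j * (fderiv ℝ f (m + op L z) (EuclideanSpace.single i 1) * z j) := fun z => by
    rw [op_apply_eq_sum B]
    simp only [map_sum, map_smul, smul_eq_mul]
    refine Finset.sum_congr rfl fun i _ => Finset.sum_congr rfl fun j _ => by ring
  have hint2 : ∀ i j, Integrable (fun z =>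
      B i j * (fderiv ℝ f (m + op L z) (EuclideanSpace.single i 1) * z j)) (γ n) := by
    intro i j
    refine Integrable.const_mul (integrable_stdGaussian_of_norm_le_mul
        ((hcont.clm_apply continuous_const).mul (by fun_prop)).aestronglyMeasurable hp hq
        le_rfl zero_le_one (fun z => ?_)) _
    rw [Pi.mul_apply, norm_mul]
    refine mul_le_mul ?_ ?_ (norm_nonneg _) (by positivity)
    · refine ((fderiv ℝ f (m + op L z)).le_opNorm _).trans ?_
      simpa using hpq z
    · simpa using PiLp.norm_apply_le z j
  simp_rw [hexp]
  rw [integral_finsetSum _ fun i _ => integrable_finsetSum _ fun j _ => hint2 i j]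
  simp_rw [integral_finsetSum _ fun j _ => hint2 _ j, integral_const_mul, hstein]
  rw [Matrix.mul_assoc]
  simp only [Matrix.trace, Matrix.diag, Matrix.mul_apply, Matrix.transpose_apply]
  rw [Finset.sum_comm]
  refine Finset.sum_congr rfl fun j _ => Finset.sum_congr rfl fun i _ => ?_
  congr 1
  refine Finset.sum_congr rfl fun k _ => ?_
  rw [hsym k i]; ring

/-- The expectation of `log ρ` under `N(m, L Lᵀ)`. -/
def meanLog (ρ : E n → ℝ) (m : E n) (L : Mat n) : ℝ :=
  ∫ z, logDensity ρ (m + op L z) ∂(γ n)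

theorem integral_fderiv_affine (hf : IsPinched (logDensity ρ) α β) (m : E n) (L : Mat n)
    (d : E n) (B : Mat n) :
    ∫ z, fderiv ℝ (logDensity ρ) (m + op L z) (d + op B z) ∂(γ n)
      = inner ℝ (meanScore ρ m (L * Lᵀ)) d + (Bᵀ * (meanHessian ρ m (L * Lᵀ)) * L).trace := by
  simp_rw [map_add]
  rw [integral_add, inner_meanScore hf, integral_fderiv_op hf]
  · simpa using hf.integrable_fderiv_affine m L d 0
  · simpa using hf.integrable_fderiv_affine m L 0 B

theorem integrable_norm_sq_affine (d : E n) (B : Mat n) :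
    Integrable (fun z => ‖d + op B z‖ ^ 2) (γ n) := by
  refine integrable_stdGaussian_of_norm_le_mul
    (by fun_prop : Continuous fun z => ‖d + op B z‖ ^ 2).aestronglyMeasurable
    (norm_nonneg d) (norm_nonneg (op B)) (norm_nonneg d) (norm_nonneg (op B)) fun z => ?_
  rw [norm_pow, norm_norm, pow_two]
  gcongr <;> exact norm_affine_le d B z

theorem integrable_taylor (hf : IsPinched (logDensity ρ) α β) (m : E n) (L : Mat n)
    (d : E n) (B : Mat n) (c : ℝ) :
    Integrable (fun z => logDensity ρ (m + op L z)
      + fderiv ℝ (logDensity ρ) (m + op L z) (d + op B z) - c * ‖d + op B z‖ ^ 2) (γ n) :=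
  ((hf.integrable_affine m L).add (hf.integrable_fderiv_affine m L d B)).sub
    ((integrable_norm_sq_affine d B).const_mul c)

theorem integral_taylor (hf : IsPinched (logDensity ρ) α β) (m : E n) (L : Mat n)
    (d : E n) (B : Mat n) (c : ℝ) :
    ∫ z, (logDensity ρ (m + op L z) + fderiv ℝ (logDensity ρ) (m + op L z) (d + op B z)
      - c * ‖d + op B z‖ ^ 2) ∂(γ n)
      = meanLog ρ m L + inner ℝ (meanScore ρ m (L * Lᵀ)) d
        + (Bᵀ * (meanHessian ρ m (L * Lᵀ)) * L).trace - c * (‖d‖ ^ 2 + (Bᵀ * B).trace) := by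
  have h1 := hf.integrable_affine m L
  have h2 := hf.integrable_fderiv_affine m L d B
  have h12 : Integrable (fun z => logDensity ρ (m + op L z)
      + fderiv ℝ (logDensity ρ) (m + op L z) (d + op B z)) (γ n) := h1.add h2
  rw [integral_sub h12 ((integrable_norm_sq_affine d B).const_mul c), integral_add h1 h2,
    integral_const_mul, integral_norm_sq_affine, integral_fderiv_affine hf, meanLog]
  ring

theorem affine_add (m d : E n) (L B : Mat n) (z : E n) :
    m + d + op (L + B) z = m + op L z + (d + op B z) := by
  simp only [op, map_add, add_apply]; abel

/-- The pointwise Taylor bound with displacement `d + B z`, integrated over `z`. Nothing is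
differentiated under the integral sign. -/
theorem meanLog_add_le (hf : IsPinched (logDensity ρ) α β) (m : E n) (L : Mat n)
    (d : E n) (B : Mat n) :
    meanLog ρ (m + d) (L + B) ≤ meanLog ρ m L + inner ℝ (meanScore ρ m (L * Lᵀ)) d
      + (Bᵀ * (meanHessian ρ m (L * Lᵀ)) * L).trace
      - α / 2 * (‖d‖ ^ 2 + (Bᵀ * B).trace) := by
  rw [← integral_taylor hf]
  refine integral_mono (hf.integrable_affine _ _) (integrable_taylor hf m L d B _) fun z => ?_
  rw [affine_add]
  exact hf.le_taylor (m + op L z) (d + op B z)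

theorem le_meanLog_add (hf : IsPinched (logDensity ρ) α β) (m : E n) (L : Mat n)
    (d : E n) (B : Mat n) :
    meanLog ρ m L + inner ℝ (meanScore ρ m (L * Lᵀ)) d
      + (Bᵀ * (meanHessian ρ m (L * Lᵀ)) * L).trace
      - β / 2 * (‖d‖ ^ 2 + (Bᵀ * B).trace) ≤ meanLog ρ (m + d) (L + B) := by
  rw [← integral_taylor hf]
  refine integral_mono (integrable_taylor hf m L d B _) (hf.integrable_affine _ _) fun z => ?_
  rw [affine_add]
  exact hf.taylor_le (m + op L z) (d + op B z)

end Expectations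

/-! ### An explicit formula for the divergence. -/

section Divergence

variable {ρ : E n → ℝ} {α β : ℝ}

theorem continuous_density (hρ : IsPosDensity ρ) (hf : IsPinched (logDensity ρ) α β) :
    Continuous ρ := by
  have : ρ = fun x => Real.exp (logDensity ρ x) := by
    ext x
    rw [logDensity, Real.exp_log (hρ.pos x)]
  rw [this]
  exact Real.continuous_exp.comp hf.continuous

theorem isProbabilityMeasure_law (hρ : IsPosDensity ρ) : IsProbabilityMeasure (law ρ) := by
  have hi : Integrable ρ := by
    by_contra h
    have := hρ.integral_eq_one
    rw [integral_undef h] at this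
    norm_num at this
  constructor
  rw [law, withDensity_apply _ MeasurableSet.univ, Measure.restrict_univ,
    ← ofReal_integral_eq_lintegral_ofReal hi (Filter.Eventually.of_forall fun x => (hρ.pos x).le),
    hρ.integral_eq_one, ENNReal.ofReal_one]

theorem multivariateGaussian_eq_withDensity_law (hρ : IsPosDensity ρ) (hc : Continuous ρ)
    (m : E n) {R : Mat n} (hR : R.det ≠ 0) :
    multivariateGaussian m (R * Rᵀ)
      = (law ρ).withDensity (fun x => ENNReal.ofReal (gaussDensity m R x / ρ x)) := by
  have hg := continuous_gaussDensity m R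
  rw [multivariateGaussian_eq_withDensity m hR, law, ← withDensity_mul _ (by fun_prop)
    (show Measurable fun x => ENNReal.ofReal (gaussDensity m R x / ρ x) from
      (hg.measurable.div hc.measurable).ennreal_ofReal)]
  congr 1
  ext x
  rw [Pi.mul_apply, ← ENNReal.ofReal_mul (hρ.pos x).le, mul_div_cancel₀ _ (hρ.pos x).ne']

theorem log_gaussDensity (m : E n) {R : Mat n} (hR : R.det ≠ 0) (z : E n) :
    Real.log (gaussDensity m R (m + op R z))
      = -(Real.log |R.det| + n * Real.log (Real.sqrt (2 * Real.pi))) - 1 / 2 * ‖z‖ ^ 2 := by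
  have e1 : op R⁻¹ (op R z) = z := by
    rw [← op_mul_apply, Matrix.nonsing_inv_mul _ hR.isUnit]; simp
  have h1 : |R.det| ≠ 0 := abs_ne_zero.2 hR
  have h2 : Real.sqrt (2 * Real.pi) ≠ 0 := by positivity
  rw [gaussDensity, add_sub_cancel_left, e1, stdDensity, Real.log_mul (inv_ne_zero h1)
    (by positivity), Real.log_mul (by positivity) (Real.exp_ne_zero _), Real.log_exp,
    Real.log_inv, Real.log_inv, Real.log_pow]
  ring

theorem llr_multivariateGaussian_law (hρ : IsPosDensity ρ) (hc : Continuous ρ)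
    (m : E n) {R : Mat n} (hR : R.det ≠ 0) :
    llr (multivariateGaussian m (R * Rᵀ)) (law ρ) =ᵐ[multivariateGaussian m (R * Rᵀ)]
      fun x => Real.log (gaussDensity m R x) - logDensity ρ x := by
  have := isProbabilityMeasure_law hρ
  have hN := multivariateGaussian_eq_withDensity_law hρ hc m hR
  have hac : multivariateGaussian m (R * Rᵀ) ≪ law ρ := by
    rw [hN]; exact withDensity_absolutelyContinuous _ _
  have hrn := Measure.rnDeriv_withDensity (law ρ)
    (((continuous_gaussDensity m R).measurable.div hc.measurable).ennreal_ofReal)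
  simp only [Pi.div_apply] at hrn
  rw [← hN] at hrn
  filter_upwards [hac.ae_le hrn] with x hx
  rw [llr, hx, ENNReal.toReal_ofReal (div_nonneg (gaussDensity_pos m hR x).le (hρ.pos x).le),
    Real.log_div (gaussDensity_pos m hR x).ne' (hρ.pos x).ne', logDensity]

theorem gaussKL_mul_transpose (hρ : IsPosDensity ρ) (hf : IsPinched (logDensity ρ) α β)
    (m : E n) {R : Mat n} (hR : R.det ≠ 0) :
    gaussKL ρ m (R * Rᵀ) ≠ ∞ ∧ (gaussKL ρ m (R * Rᵀ)).toReal
      = -(n * Real.log (Real.sqrt (2 * Real.pi)) + n / 2) - meanLog ρ m R - Real.log |R.det| := by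
  have hc := continuous_density hρ hf
  have := isProbabilityMeasure_law hρ
  have hN := multivariateGaussian_eq_withDensity_law hρ hc m hR
  have hac : multivariateGaussian m (R * Rᵀ) ≪ law ρ := by
    rw [hN]; exact withDensity_absolutelyContinuous _ _
  have hllr := llr_multivariateGaussian_law hρ hc m hR
  have hgc := continuous_gaussDensity m R
  have hcont : Continuous fun x => Real.log (gaussDensity m R x) - logDensity ρ x :=
    (hgc.log fun x => (gaussDensity_pos m hR x).ne').sub hf.continuous
  have hsq : Integrable (fun z : E n => ‖z‖ ^ 2) (γ n) := integrable_norm_pow_stdGaussian 2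
  have h1 : Integrable (fun z : E n =>
      -(Real.log |R.det| + n * Real.log (Real.sqrt (2 * Real.pi))) - 1 / 2 * ‖z‖ ^ 2) (γ n) :=
    (integrable_const _).sub (hsq.const_mul _)
  have h2 := hf.integrable_affine m R
  have hint : Integrable (fun x => Real.log (gaussDensity m R x) - logDensity ρ x)
      (multivariateGaussian m (R * Rᵀ)) := by
    rw [← map_affine_stdGaussian, integrable_map_measure hcont.aestronglyMeasurable (by fun_prop)]
    refine (h1.sub h2).congr (Filter.Eventually.of_forall fun z => ?_)
    simp only [Pi.sub_apply, Function.comp_apply, log_gaussDensity m hR]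
  have hill : Integrable (llr (multivariateGaussian m (R * Rᵀ)) (law ρ))
      (multivariateGaussian m (R * Rᵀ)) := hint.congr hllr.symm
  refine ⟨klDiv_ne_top hac hill, ?_⟩
  rw [gaussKL, toReal_klDiv_of_measure_eq hac (by simp), integral_congr_ae hllr,
    integral_multivariateGaussian_mul_transpose m R _ hcont.stronglyMeasurable]
  simp_rw [log_gaussDensity m hR]
  rw [integral_sub h1 h2, integral_sub (integrable_const _) (hsq.const_mul _), integral_const_mul]
  -- The second moment of the standard Gaussian is `n`, whence the constant `n / 2`.
  have := integral_norm_sq_affine (0 : E n) (1 : Mat n)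
  simp only [op, map_one, zero_add, norm_zero, one_apply_eq_self, Matrix.transpose_one, mul_one, Matrix.trace_one,
    Fintype.card_fin] at this
  rw [this]
  simp [meanLog]
  ring

/-- `KL[N(m, C) ‖ ρ]` as a real number, in terms of a positive definite square root of `C`. -/
theorem gaussKL_toReal (hρ : IsPosDensity ρ) (hf : IsPinched (logDensity ρ) α β)
    (m : E n) {C : Mat n} (hC : C.PosDef) :
    gaussKL ρ m C ≠ ∞ ∧ (gaussKL ρ m C).toReal
      = -(n * Real.log (Real.sqrt (2 * Real.pi)) + n / 2) - meanLog ρ m (CFC.sqrt C)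
        - Real.log C.det / 2 := by
  have hR := posDef_sqrt hC
  have h := gaussKL_mul_transpose hρ hf m hR.det_pos.ne'
  rw [transpose_of_isHermitian hR.isHermitian, sqrt_mul_sqrt hC, abs_of_pos hR.det_pos] at h
  have h2 : Real.log C.det = 2 * Real.log (CFC.sqrt C).det := by
    conv_lhs => rw [← sqrt_mul_sqrt hC, Matrix.det_mul,
      Real.log_mul hR.det_pos.ne' hR.det_pos.ne']
    ring
  rw [h2]
  refine ⟨h.1, h.2.trans ?_⟩
  ring

end Divergence

/-! ### Convexity along couplings: Polyak–Łojasiewicz inequality and quadratic growth. -/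

section Coupling

/-- With `R = √C`, take `1 + K = (R⁻¹ D R⁻¹)^(1/2)`. Driving both Gaussians by the same `z` through
`R` and `R (1 + K)` need not be an optimal coupling, but an upper bound on `W2` needs only some
coupling, and here the determinant factors. -/
theorem sqrt_conj {C D : Mat n} (hC : C.PosDef) (hD : D.PosDef) :
    ∃ K : Mat n, Kᵀ = K ∧ (1 + K).PosDef ∧
      CFC.sqrt C * (1 + K) * ((1 + K) * CFC.sqrt C) = D := by
  set R := CFC.sqrt C
  have hR : R.PosDef := posDef_sqrt hC
  have hP : (R⁻¹ * D * R⁻¹).PosDef := by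
    have := posDef_conj hD hR.inv.det_pos.ne'
    rwa [transpose_of_isHermitian hR.inv.isHermitian] at this
  refine ⟨CFC.sqrt (R⁻¹ * D * R⁻¹) - 1, ?_, ?_, ?_⟩
  · rw [Matrix.transpose_sub, Matrix.transpose_one,
      transpose_of_isHermitian (posDef_sqrt hP).isHermitian]
  · rw [add_sub_cancel]; exact posDef_sqrt hP
  · have h1 := Matrix.mul_nonsing_inv R hR.det_pos.ne'.isUnit
    have h2 := Matrix.nonsing_inv_mul R hR.det_pos.ne'.isUnit
    rw [add_sub_cancel, mul_assoc, ← mul_assoc (CFC.sqrt _) (CFC.sqrt _) R, sqrt_mul_sqrt hP]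
    calc R * (R⁻¹ * D * R⁻¹ * R) = (R * R⁻¹) * D * (R⁻¹ * R) := by simp only [mul_assoc]
      _ = D := by rw [h1, h2, one_mul, mul_one]

variable {ρ : E n → ℝ} {α β : ℝ}

theorem meanLog_eq (hf : IsPinched (logDensity ρ) α β) (m : E n) (L : Mat n) :
    meanLog ρ m L = ∫ x, logDensity ρ x ∂(multivariateGaussian m (L * Lᵀ)) :=
  (integral_multivariateGaussian_mul_transpose m L _ hf.continuous.stronglyMeasurable).symm

/-- Allows `R (1 + K)`, which need not be symmetric, to be exchanged for the symmetric root of the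
same covariance. -/
theorem meanLog_congr (hf : IsPinched (logDensity ρ) α β) (m : E n) {L L' : Mat n}
    (h : L * Lᵀ = L' * L'ᵀ) : meanLog ρ m L = meanLog ρ m L' := by
  rw [meanLog_eq hf, meanLog_eq hf, h]

theorem transpose_meanHessian (hf : IsPinched (logDensity ρ) α β) (m : E n) (C : Mat n) :
    (meanHessian ρ m C)ᵀ = meanHessian ρ m C := by
  ext i j
  simp only [Matrix.transpose_apply, meanHessian, Matrix.of_apply]
  refine integral_congr_ae (Filter.Eventually.of_forall fun z => ?_)
  exact hf.symm _ _ _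

theorem sqrt_mul_transpose {C : Mat n} (hC : C.PosDef) :
    CFC.sqrt C * (CFC.sqrt C)ᵀ = C := by
  rw [transpose_of_isHermitian (posDef_sqrt hC).isHermitian, sqrt_mul_sqrt hC]

theorem coupling_mul_transpose {C D K : Mat n} (hC : C.PosDef) (hK : Kᵀ = K)
    (h : CFC.sqrt C * (1 + K) * ((1 + K) * CFC.sqrt C) = D) :
    (CFC.sqrt C + CFC.sqrt C * K) * (CFC.sqrt C + CFC.sqrt C * K)ᵀ = D := by
  have hR := transpose_of_isHermitian (posDef_sqrt hC).isHermitian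
  rw [Matrix.transpose_add, Matrix.transpose_mul, hK, hR, ← h]
  noncomm_ring

theorem coupling_transpose_mul_self {C K : Mat n} (hC : C.PosDef) (hK : Kᵀ = K) :
    (CFC.sqrt C * K)ᵀ * (CFC.sqrt C * K) = K * C * K := by
  have hR := transpose_of_isHermitian (posDef_sqrt hC).isHermitian
  rw [Matrix.transpose_mul, hK, hR, ← mul_assoc, mul_assoc K, sqrt_mul_sqrt hC]

/-- The derivative of `C ↦ -2 KL[N(m, C) ‖ ρ]`. -/
def covScore (ρ : E n → ℝ) (m : E n) (C : Mat n) : Mat n := meanHessian ρ m C + C⁻¹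

theorem transpose_covScore (hf : IsPinched (logDensity ρ) α β) (m : E n) {C : Mat n}
    (hC : C.PosDef) : (covScore ρ m C)ᵀ = covScore ρ m C := by
  rw [covScore, Matrix.transpose_add, transpose_meanHessian hf,
    transpose_of_isHermitian hC.inv.isHermitian]

/-- Strong concavity of `meanLog` with increment `B = √C K`, combined with `log det (1 + K) ≤ tr K`.
The term `tr K` is the `C⁻¹` part of `covScore`, because `√C C⁻¹ √C = 1`. -/
theorem gaussKL_toReal_ge (hρ : IsPosDensity ρ) (hf : IsPinched (logDensity ρ) α β)
    (m d : E n) {C D K : Mat n} (hC : C.PosDef) (hD : D.PosDef) (hK : Kᵀ = K)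
    (hQ : (1 + K).PosDef) (h : CFC.sqrt C * (1 + K) * ((1 + K) * CFC.sqrt C) = D) :
    (gaussKL ρ m C).toReal - inner ℝ (meanScore ρ m C) d
        - (K * CFC.sqrt C * covScore ρ m C * CFC.sqrt C).trace
        + α / 2 * (‖d‖ ^ 2 + (K * C * K).trace)
      ≤ (gaussKL ρ (m + d) D).toReal := by
  have hR := posDef_sqrt hC
  have hRT := transpose_of_isHermitian hR.isHermitian
  rw [(gaussKL_toReal hρ hf m hC).2, (gaussKL_toReal hρ hf (m + d) hD).2]
  have h1 := meanLog_add_le hf m (CFC.sqrt C) d (CFC.sqrt C * K)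
  rw [sqrt_mul_transpose hC, coupling_transpose_mul_self hC hK,
    meanLog_congr hf (m + d) ((coupling_mul_transpose hC hK h).trans (sqrt_mul_transpose hD).symm),
    Matrix.transpose_mul, hK, hRT] at h1
  have h2 : Real.log D.det = Real.log C.det + 2 * Real.log (1 + K).det := by
    have : D.det = C.det * (1 + K).det ^ 2 := by
      rw [← h, Matrix.det_mul, Matrix.det_mul, Matrix.det_mul]
      conv_rhs => rw [← sqrt_mul_sqrt hC, Matrix.det_mul]
      ring
    rw [this, Real.log_mul hC.det_pos.ne' (pow_ne_zero _ hQ.det_pos.ne'), Real.log_pow]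
    norm_num
  have h3 := log_det_le_trace_sub hQ
  rw [Matrix.trace_add, Matrix.trace_one, Fintype.card_fin] at h3
  have h4 : (K * CFC.sqrt C * covScore ρ m C * CFC.sqrt C).trace
      = (K * CFC.sqrt C * meanHessian ρ m C * CFC.sqrt C).trace + K.trace := by
    rw [covScore, mul_add, add_mul, Matrix.trace_add]
    congr 2
    have e : C⁻¹ = (CFC.sqrt C)⁻¹ * (CFC.sqrt C)⁻¹ := by
      conv_lhs => rw [← sqrt_mul_sqrt hC, Matrix.mul_inv_rev]
    have h1 := Matrix.mul_nonsing_inv _ hR.det_pos.ne'.isUnit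
    have h2 := Matrix.nonsing_inv_mul _ hR.det_pos.ne'.isUnit
    calc K * CFC.sqrt C * C⁻¹ * CFC.sqrt C
        = K * (CFC.sqrt C * (CFC.sqrt C)⁻¹) * ((CFC.sqrt C)⁻¹ * CFC.sqrt C) := by
          rw [e]; simp only [mul_assoc]
      _ = K := by rw [h1, h2, mul_one, mul_one]
  rw [h2, h4]
  linarith

/-- The Polyak–Łojasiewicz inequality for `KL[· ‖ ρ]` in the Wasserstein geometry. -/
theorem gaussKL_polyak_lojasiewicz (hα : 0 < α) (hρ : IsPosDensity ρ)
    (hf : IsPinched (logDensity ρ) α β) (m m' : E n) {C C' : Mat n} (hC : C.PosDef)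
    (hC' : C'.PosDef) :
    2 * α * ((gaussKL ρ m C).toReal - (gaussKL ρ m' C').toReal)
      ≤ ‖meanScore ρ m C‖ ^ 2 + (covScore ρ m C * C * covScore ρ m C).trace := by
  obtain ⟨K, hK, hQ, h⟩ := sqrt_conj hC hC'
  have key := gaussKL_toReal_ge hρ hf m (m' - m) hC hC' hK hQ h
  rw [add_sub_cancel] at key
  set R := CFC.sqrt C with hRdef
  set S := covScore ρ m C with hS
  set s := meanScore ρ m C
  set d := m' - m
  have hRT : Rᵀ = R := transpose_of_isHermitian (posDef_sqrt hC).isHermitian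
  have hST : Sᵀ = S := transpose_covScore hf m hC
  have hRR : R * R = C := sqrt_mul_sqrt hC
  -- The squares are `‖s - α d‖²` here and the Frobenius norm squared of `α R K - S R` next; they
  -- absorb the terms linear in `d` and `K` of `2α · key`.
  have h1 : 0 ≤ ‖s‖ ^ 2 - 2 * (α * inner ℝ s d) + α ^ 2 * ‖d‖ ^ 2 := by
    have := norm_sub_sq_real s (α • d)
    rw [inner_smul_right, norm_smul, mul_pow, Real.norm_eq_abs, sq_abs] at this
    rw [← this]; positivity
  have h2 : 0 ≤ α ^ 2 * (K * C * K).trace - 2 * α * (K * R * S * R).trace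
      + (S * C * S).trace := by
    have := trace_transpose_mul_self_nonneg (α • (R * K) - S * R)
    rw [Matrix.transpose_sub, Matrix.transpose_smul, Matrix.transpose_mul, Matrix.transpose_mul,
      hRT, hK, hST, sub_mul, mul_sub, mul_sub, Matrix.trace_sub, Matrix.trace_sub,
      Matrix.trace_sub] at this
    simp only [Matrix.smul_mul, Matrix.mul_smul, Matrix.trace_smul, smul_eq_mul] at this
    have e1 : (K * R * (R * K)).trace = (K * C * K).trace := by
      rw [← hRR]; simp only [mul_assoc]
    have e2 : (K * R * (S * R)).trace = (K * R * S * R).trace := by simp only [mul_assoc]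
    have e3 : (R * S * (R * K)).trace = (K * R * S * R).trace := by
      rw [← mul_assoc (R * S), Matrix.trace_mul_comm]; simp only [mul_assoc]
    have e4 : (R * S * (S * R)).trace = (S * C * S).trace := by
      rw [Matrix.trace_mul_comm, ← hRR]
      simp only [mul_assoc]
    rw [e1, e2, e3, e4] at this
    linarith
  nlinarith [mul_le_mul_of_nonneg_left key hα.le]

/-- Quadratic growth of `KL[· ‖ ρ]` away from a critical point, in Wasserstein distance. -/
theorem W2_sq_le_of_critical (hα : 0 < α) (hρ : IsPosDensity ρ)
    (hf : IsPinched (logDensity ρ) α β) (m m' : E n) {C C' : Mat n} (hC : C.PosDef)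
    (hC' : C'.PosDef) (hs : meanScore ρ m C = 0) (hS : covScore ρ m C = 0) :
    W2 (multivariateGaussian m' C') (multivariateGaussian m C) ^ 2
      ≤ ENNReal.ofReal (2 / α * ((gaussKL ρ m' C').toReal - (gaussKL ρ m C).toReal)) := by
  obtain ⟨K, hK, hQ, h⟩ := sqrt_conj hC hC'
  have key := gaussKL_toReal_ge hρ hf m (m' - m) hC hC' hK hQ h
  have hL1 := coupling_mul_transpose hC hK h
  rw [add_sub_cancel, hs, hS, inner_zero_left, mul_zero, zero_mul, Matrix.trace_zero] at key
  set R := CFC.sqrt C with hRdef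
  have hsq : ∀ x : ℝ≥0∞, (x ^ (1 / 2 : ℝ)) ^ 2 = x := fun x => by
    rw [← ENNReal.rpow_natCast, ← ENNReal.rpow_mul]; norm_num
  rw [W2, hsq]
  -- The cost of this coupling is `‖m' - m‖² + tr(K C K)`, exactly the quadratic term of `key`.
  refine (iInf₂_le ((γ n).map fun z => (m' + op (R + R * K) z, m + op R z)) ⟨?_, ?_⟩).trans ?_
  rotate_left
  · rw [Measure.map_map measurable_fst (by fun_prop)]
    change (γ n).map (fun z => m' + op (R + R * K) z) = _
    rw [map_affine_stdGaussian, hL1]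
  · rw [Measure.map_map measurable_snd (by fun_prop)]
    change (γ n).map (fun z => m + op R z) = _
    rw [map_affine_stdGaussian, sqrt_mul_transpose hC]
  · rw [lintegral_map (by fun_prop) (by fun_prop)]
    have e : ∀ z : E n, m' + op (R + R * K) z - (m + op R z) = (m' - m) + op (R * K) z := by
      intro z
      simp only [op, map_add, add_apply]; abel
    simp only [e]
    rw [← ofReal_integral_eq_lintegral_ofReal (integrable_norm_sq_affine _ _)
      (Filter.Eventually.of_forall fun z => by positivity), integral_norm_sq_affine,
      coupling_transpose_mul_self hC hK]
    apply ENNReal.ofReal_le_ofReal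
    rw [div_mul_eq_mul_div, le_div_iff₀ hα]
    linarith

theorem gaussKL_minimizer_of_critical (hα : 0 < α) (hρ : IsPosDensity ρ)
    (hf : IsPinched (logDensity ρ) α β) (m m' : E n) {C C' : Mat n} (hC : C.PosDef)
    (hC' : C'.PosDef) (hs : meanScore ρ m C = 0) (hS : covScore ρ m C = 0)
    (hle : (gaussKL ρ m' C').toReal ≤ (gaussKL ρ m C).toReal) : m' = m ∧ C' = C := by
  obtain ⟨K, hK, hQ, h⟩ := sqrt_conj hC hC'
  have key := gaussKL_toReal_ge hρ hf m (m' - m) hC hC' hK hQ h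
  rw [add_sub_cancel, hs, hS, inner_zero_left, mul_zero, zero_mul, Matrix.trace_zero] at key
  have h1 : 0 ≤ (K * C * K).trace := by
    rw [← coupling_transpose_mul_self hC hK]; exact trace_transpose_mul_self_nonneg _
  have h2 : 0 ≤ ‖m' - m‖ ^ 2 := by positivity
  have h3 : ‖m' - m‖ ^ 2 + (K * C * K).trace ≤ 0 := by
    by_contra! hcon
    have := mul_pos (half_pos hα) hcon
    linarith
  have h4 : ‖m' - m‖ ^ 2 = 0 := by linarith
  have h5 : (K * C * K).trace = 0 := by linarith
  rw [← coupling_transpose_mul_self hC hK] at h5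
  have h6 := eq_zero_of_trace_transpose_mul_self h5
  have hK0 : K = 0 := by
    have := congrArg ((CFC.sqrt C)⁻¹ * ·) h6
    simpa [← mul_assoc, Matrix.nonsing_inv_mul _ (posDef_sqrt hC).det_pos.ne'.isUnit] using this
  refine ⟨by simpa [sub_eq_zero] using h4, ?_⟩
  rw [← h, hK0]
  simp [sqrt_mul_sqrt hC]

end Coupling

/-! ### Differentiating the divergence along a curve. -/

section Derivative

open Asymptotics Topology Filter

/-- Reads derivatives off two-sided estimates, so that the matrix square root never has to be
differentiated. -/
theorem hasDerivWithinAt_of_abs_sub_le {g l φ : ℝ → ℝ} {l' t₀ : ℝ} {s : Set ℝ}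
    (hl : HasDerivWithinAt l l' s t₀) (hφ : φ =o[𝓝[s] t₀] fun t => t - t₀)
    (h : ∀ t ∈ s, |g t - g t₀ - (l t - l t₀)| ≤ φ t) : HasDerivWithinAt g l' s t₀ := by
  rw [hasDerivWithinAt_iff_isLittleO] at hl ⊢
  have h1 : (fun t => g t - g t₀ - (l t - l t₀)) =o[𝓝[s] t₀] fun t => t - t₀ := by
    refine IsBigO.trans_isLittleO (IsBigO.of_bound 1 ?_) hφ
    filter_upwards [self_mem_nhdsWithin] with t ht
    rw [one_mul, Real.norm_eq_abs, Real.norm_eq_abs]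
    exact (h t ht).trans (le_abs_self _)
  refine (h1.add hl).congr_left fun t => ?_
  ring

theorem hasDerivWithinAt_trace_mul {C : ℝ → Mat n} {C' A : Mat n} {s : Set ℝ} {t₀ : ℝ}
    (hC : ∀ i j, HasDerivWithinAt (fun t => C t i j) (C' i j) s t₀) :
    HasDerivWithinAt (fun t => (A * C t).trace) (A * C').trace s t₀ := by
  simp only [Matrix.trace, Matrix.diag, Matrix.mul_apply]
  exact HasDerivWithinAt.fun_sum fun i _ => HasDerivWithinAt.fun_sum fun j _ =>
    (hC j i).const_mul _

theorem hasDerivWithinAt_conj {C : ℝ → Mat n} {C' : Mat n} (A B : Mat n) {s : Set ℝ} {t₀ : ℝ}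
    (hC : ∀ i j, HasDerivWithinAt (fun t => C t i j) (C' i j) s t₀) (i j : Fin n) :
    HasDerivWithinAt (fun t => (A * C t * B) i j) ((A * C' * B) i j) s t₀ := by
  simp only [Matrix.mul_apply]
  exact HasDerivWithinAt.fun_sum fun k _ => (HasDerivWithinAt.fun_sum fun l _ =>
    (hC l k).const_mul _).mul_const _

theorem continuousWithinAt_matrix {C : ℝ → Mat n} {C' : Mat n} {s : Set ℝ} {t₀ : ℝ}
    (hC : ∀ i j, HasDerivWithinAt (fun t => C t i j) (C' i j) s t₀) :
    ContinuousWithinAt C s t₀ :=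
  continuousWithinAt_pi.2 fun i => continuousWithinAt_pi.2 fun j => (hC i j).continuousWithinAt

/-- The tangent inequality at both ends traps the increment between the traces of `(C t)⁻¹ (C t - C
t₀)` and `(C t₀)⁻¹ (C t - C t₀)`, which differ by `o(t - t₀)`. -/
theorem hasDerivWithinAt_log_det {C : ℝ → Mat n} {C' : Mat n} {s : Set ℝ} {t₀ : ℝ}
    (ht₀ : t₀ ∈ s) (hpd : ∀ t ∈ s, (C t).PosDef)
    (hC : ∀ i j, HasDerivWithinAt (fun t => C t i j) (C' i j) s t₀) :
    HasDerivWithinAt (fun t => Real.log (C t).det) ((C t₀)⁻¹ * C').trace s t₀ := by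
  have hinv : Tendsto (fun t => (C t)⁻¹) (𝓝[s] t₀) (𝓝 (C t₀)⁻¹) := by
    refine (continuousAt_matrix_inv (C t₀) ?_).tendsto.comp (continuousWithinAt_matrix hC)
    rw [Ring.inverse_eq_inv']
    exact continuousAt_inv₀ (hpd t₀ ht₀).det_pos.ne'
  have hφ : (fun t => (((C t₀)⁻¹ - (C t)⁻¹) * (C t - C t₀)).trace) =o[𝓝[s] t₀]
      fun t => t - t₀ := by
    simp only [Matrix.trace, Matrix.diag, Matrix.mul_apply]
    refine IsLittleO.fun_sum fun i _ => IsLittleO.fun_sum fun j _ => ?_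
    have h1 : (fun t => ((C t₀)⁻¹ - (C t)⁻¹) i j) =o[𝓝[s] t₀] fun _ => (1 : ℝ) := by
      rw [isLittleO_one_iff]
      have := ((tendsto_pi_nhds.1 ((tendsto_pi_nhds.1 hinv) i)) j).const_sub ((C t₀)⁻¹ i j)
      simpa using this
    have h2 := (hC j i).hasFDerivWithinAt.isBigO_sub
    simpa using h1.mul_isBigO h2
  refine hasDerivWithinAt_of_abs_sub_le
    (l := fun t => ((C t₀)⁻¹ * C t).trace) (hasDerivWithinAt_trace_mul hC) hφ fun t ht => ?_
  have h1 := log_det_sub_le (hpd t₀ ht₀) (hpd t ht)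
  have h2 := log_det_sub_le (hpd t ht) (hpd t₀ ht₀)
  rw [← neg_sub (C t), mul_neg, Matrix.trace_neg] at h2
  rw [sub_mul, Matrix.trace_sub, ← Matrix.trace_sub, ← mul_sub, abs_le]
  constructor <;> linarith

theorem abs_trace_mul_self_mul_le {K : Mat n} (hK : Kᵀ = K) (N : Mat n) :
    |(K * K * N).trace| ≤ (∑ i, ∑ j, |N i j|) * (Kᵀ * K).trace := by
  have h : ∀ i j, |(K * K) i j| ≤ (Kᵀ * K).trace := by
    intro i j
    rw [trace_transpose_mul_self, Matrix.mul_apply]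
    have hs : ∀ k l, K k l = K l k := fun k l => by
      conv_lhs => rw [← hK]
      rfl
    have hrow : ∀ i, ∑ k, K i k ^ 2 ≤ ∑ i, ∑ j, K i j ^ 2 := fun i =>
      Finset.single_le_sum (f := fun i => ∑ k, K i k ^ 2) (fun i _ => by positivity)
        (Finset.mem_univ i)
    calc |∑ k, K i k * K k j| ≤ ∑ k, |K i k * K k j| := Finset.abs_sum_le_sum_abs _ _
      _ ≤ ∑ k, (K i k ^ 2 / 2 + K j k ^ 2 / 2) := by
          refine Finset.sum_le_sum fun k _ => ?_
          rw [hs k j, abs_mul, ← sq_abs (K i k), ← sq_abs (K j k)]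
          nlinarith [sq_nonneg (|K i k| - |K j k|)]
      _ = (∑ k, K i k ^ 2) / 2 + (∑ k, K j k ^ 2) / 2 := by
          rw [Finset.sum_add_distrib, Finset.sum_div, Finset.sum_div]
      _ ≤ _ := by linarith [hrow i, hrow j]
  simp only [Matrix.trace, Matrix.diag]
  rw [show (∑ i, (K * K * N) i i) = ∑ i, ∑ j, (K * K) i j * N j i by simp [Matrix.mul_apply],
    Finset.sum_comm, Finset.sum_mul]
  refine (Finset.abs_sum_le_sum_abs _ _).trans (Finset.sum_le_sum fun j _ => ?_)
  rw [Finset.sum_mul]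
  refine (Finset.abs_sum_le_sum_abs _ _).trans (Finset.sum_le_sum fun i _ => ?_)
  rw [abs_mul, mul_comm]
  exact mul_le_mul_of_nonneg_left (h i j) (abs_nonneg _)

/-- On eigenvalues `k > -1` this says `k² ≤ k² (2 + k)²`. In traces, the difference is `2 tr(K (1 +
K) K) + ‖K + K²‖²`. -/
theorem trace_sq_le_of_posDef_one_add {K : Mat n} (hK : Kᵀ = K) (hQ : (1 + K).PosDef) :
    (Kᵀ * K).trace ≤ ((K + K + K * K)ᵀ * (K + K + K * K)).trace := by
  have h1 := (hQ.posSemidef.conjTranspose_mul_mul_same K).trace_nonneg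
  rw [Matrix.conjTranspose_eq_transpose_of_trivial, hK,
    show K * (1 + K) * K = K * K + K * K * K by noncomm_ring, Matrix.trace_add] at h1
  have h2 := trace_transpose_mul_self_nonneg (K + K * K)
  have h3 : (K + K * K)ᵀ * (K + K * K) = K * K + (2 : ℝ) • (K * K * K) + K * K * K * K := by
    rw [Matrix.transpose_add, Matrix.transpose_mul, hK]
    simp only [mul_add, add_mul, mul_assoc]
    module
  have h4 : (K + K + K * K)ᵀ * (K + K + K * K)
      = (4 : ℝ) • (K * K) + (4 : ℝ) • (K * K * K) + K * K * K * K := by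
    rw [Matrix.transpose_add, Matrix.transpose_add, Matrix.transpose_mul, hK]
    simp only [mul_add, add_mul, mul_assoc]
    module
  rw [h3] at h2
  rw [h4, hK]
  simp only [Matrix.trace_add, Matrix.trace_smul, smul_eq_mul] at h2 ⊢
  linarith

variable {ρ : E n → ℝ} {α β : ℝ}

/-- With `D = R (1 + K)² R` one has `D - C = R (2K + K²) R`, so the linear term in `K` is `½ tr(H (D
- C))` up to a term quadratic in `K`. The Frobenius norm of `K` is at most that of `2K + K² = R⁻¹ (D
- C) R⁻¹`. -/
theorem abs_meanLog_sub_le (hf : IsPinched (logDensity ρ) α β) (m : E n) {C : Mat n}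
    (hC : C.PosDef) : ∃ c : ℝ, 0 ≤ c ∧ ∀ (d : E n) (D : Mat n), D.PosDef →
      |meanLog ρ (m + d) (CFC.sqrt D) - meanLog ρ m (CFC.sqrt C) - inner ℝ (meanScore ρ m C) d
        - 1 / 2 * (meanHessian ρ m C * (D - C)).trace|
      ≤ c * (‖d‖ ^ 2 + (((CFC.sqrt C)⁻¹ * (D - C) * (CFC.sqrt C)⁻¹)ᵀ *
          ((CFC.sqrt C)⁻¹ * (D - C) * (CFC.sqrt C)⁻¹)).trace) := by
  set R := CFC.sqrt C with hRdef
  set H := meanHessian ρ m C with hH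
  -- `c₀` dominates both Taylor coefficients without sign assumptions; `c₁` collects the remainders
  -- quadratic in `K`.
  set c₀ := |α| / 2 + |β| / 2 with hc₀
  set c₁ := c₀ * (∑ i, ∑ j, |C i j|) + 1 / 2 * (∑ i, ∑ j, |(R * H * R) i j|) with hc₁
  have hc₀n : 0 ≤ c₀ := by positivity
  have hc₁n : 0 ≤ c₁ := by positivity
  have hR := posDef_sqrt hC
  have hRT : Rᵀ = R := transpose_of_isHermitian hR.isHermitian
  have hRR : R * R = C := sqrt_mul_sqrt hC
  have i1 := Matrix.mul_nonsing_inv R hR.det_pos.ne'.isUnit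
  have i2 := Matrix.nonsing_inv_mul R hR.det_pos.ne'.isUnit
  refine ⟨c₀ + c₁, by positivity, fun d D hD => ?_⟩
  obtain ⟨K, hK, hQ, h⟩ := sqrt_conj hC hD
  change R * (1 + K) * ((1 + K) * R) = D at h
  have hE : R⁻¹ * (D - C) * R⁻¹ = K + K + K * K := by
    have : D - C = R * (K + K + K * K) * R := by
      rw [← h, ← hRR]; noncomm_ring
    rw [this]
    calc R⁻¹ * (R * (K + K + K * K) * R) * R⁻¹
        = (R⁻¹ * R) * (K + K + K * K) * (R * R⁻¹) := by simp only [mul_assoc]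
      _ = _ := by rw [i1, i2, one_mul, mul_one]
  have htr : (H * (D - C)).trace = 2 * (K * R * H * R).trace + (K * K * (R * H * R)).trace := by
    have : D - C = R * (K + K + K * K) * R := by
      rw [← h, ← hRR]; noncomm_ring
    rw [this, Matrix.trace_mul_comm]
    rw [show R * (K + K + K * K) * R * H = R * ((K + K + K * K) * R * H) by
      simp only [mul_assoc], Matrix.trace_mul_comm]
    simp only [add_mul, Matrix.trace_add, mul_assoc]
    ring
  have u := meanLog_add_le hf m R d (R * K)
  have l := le_meanLog_add hf m R d (R * K)
  have hRRT : R * Rᵀ = C := sqrt_mul_transpose hC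
  have hB : (R * K)ᵀ * (R * K) = K * C * K := coupling_transpose_mul_self hC hK
  have hG : meanLog ρ (m + d) (R + R * K) = meanLog ρ (m + d) (CFC.sqrt D) :=
    meanLog_congr hf _ ((coupling_mul_transpose hC hK h).trans (sqrt_mul_transpose hD).symm)
  rw [hRRT, hB, hG, Matrix.transpose_mul, hK, hRT] at u l
  have b1 := abs_trace_mul_self_mul_le hK (R * H * R)
  have b2 := abs_trace_mul_self_mul_le hK C
  have b3 := trace_sq_le_of_posDef_one_add hK hQ
  have e1 : (K * C * K).trace = (K * K * C).trace := by
    rw [Matrix.trace_mul_comm, ← mul_assoc]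
  have hnn : 0 ≤ ‖d‖ ^ 2 + (K * C * K).trace := by
    have := trace_transpose_mul_self_nonneg (R * K)
    rw [hB] at this
    positivity
  have a1 : -(α / 2) * (‖d‖ ^ 2 + (K * C * K).trace) ≤ c₀ * (‖d‖ ^ 2 + (K * C * K).trace) := by
    gcongr
    linarith [neg_le_abs α, abs_nonneg β]
  have a2 : β / 2 * (‖d‖ ^ 2 + (K * C * K).trace) ≤ c₀ * (‖d‖ ^ 2 + (K * C * K).trace) := by
    gcongr
    linarith [le_abs_self β, abs_nonneg α]
  have a3 : c₀ * (K * C * K).trace + 1 / 2 * |(K * K * (R * H * R)).trace|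
      ≤ c₁ * (Kᵀ * K).trace := by
    have := mul_le_mul_of_nonneg_left ((le_abs_self _).trans b2) hc₀n
    rw [e1, hc₁]
    linarith
  have a4 := mul_le_mul_of_nonneg_left b3 hc₁n
  have a5 : 0 ≤ c₁ * ‖d‖ ^ 2 := by positivity
  have a6 : 0 ≤ c₀ * ((K + K + K * K)ᵀ * (K + K + K * K)).trace :=
    mul_nonneg hc₀n (trace_transpose_mul_self_nonneg _)
  have a7 := le_abs_self (K * K * (R * H * R)).trace
  have a8 := neg_le_abs (K * K * (R * H * R)).trace
  rw [hE, htr, abs_le]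
  constructor <;> linarith

theorem hasDerivWithinAt_meanLog (hf : IsPinched (logDensity ρ) α β) {m : ℝ → E n}
    {C : ℝ → Mat n} {m' : E n} {C' : Mat n} {s : Set ℝ} {t₀ : ℝ} (ht₀ : t₀ ∈ s)
    (hpd : ∀ t ∈ s, (C t).PosDef) (hm : HasDerivWithinAt m m' s t₀)
    (hC : ∀ i j, HasDerivWithinAt (fun t => C t i j) (C' i j) s t₀) :
    HasDerivWithinAt (fun t => meanLog ρ (m t) (CFC.sqrt (C t)))
      (inner ℝ (meanScore ρ (m t₀) (C t₀)) m'
        + 1 / 2 * (meanHessian ρ (m t₀) (C t₀) * C').trace) s t₀ := by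
  obtain ⟨c, hc, hb⟩ := abs_meanLog_sub_le hf (m t₀) (hpd t₀ ht₀)
  set R := CFC.sqrt (C t₀)
  have hl1 : HasDerivWithinAt (fun t => inner ℝ (meanScore ρ (m t₀) (C t₀)) (m t))
      (inner ℝ (meanScore ρ (m t₀) (C t₀)) m') s t₀ :=
    (innerSL ℝ (meanScore ρ (m t₀) (C t₀))).hasFDerivAt.comp_hasDerivWithinAt t₀ hm
  have hl2 := (hasDerivWithinAt_trace_mul (A := meanHessian ρ (m t₀) (C t₀)) hC).const_mul
    (1 / 2 : ℝ)
  have hφ : (fun t => c * (‖m t - m t₀‖ ^ 2 + ((R⁻¹ * (C t - C t₀) * R⁻¹)ᵀ *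
          (R⁻¹ * (C t - C t₀) * R⁻¹)).trace)) =o[𝓝[s] t₀] fun t => t - t₀ := by
    refine IsLittleO.const_mul_left (IsLittleO.add ?_ ?_) c
    · have h1 : (fun t => ‖m t - m t₀‖) =o[𝓝[s] t₀] fun _ => (1 : ℝ) := by
        rw [isLittleO_one_iff]
        simpa using (hm.continuousWithinAt.tendsto.sub_const (m t₀)).norm
      have h2 : (fun t => m t - m t₀) =O[𝓝[s] t₀] fun t => t - t₀ :=
        hm.hasFDerivWithinAt.isBigO_sub
      simpa [pow_two] using h1.mul_isBigO h2.norm_left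
    · simp only [trace_transpose_mul_self]
      refine IsLittleO.fun_sum fun i _ => IsLittleO.fun_sum fun j _ => ?_
      have h0 := hasDerivWithinAt_conj R⁻¹ R⁻¹ hC i j
      have he : ∀ t, (R⁻¹ * (C t - C t₀) * R⁻¹) i j
          = (R⁻¹ * C t * R⁻¹) i j - (R⁻¹ * C t₀ * R⁻¹) i j := fun t => by
        rw [mul_sub, sub_mul]; rfl
      simp only [he]
      have h1 : (fun t => (R⁻¹ * C t * R⁻¹) i j - (R⁻¹ * C t₀ * R⁻¹) i j) =o[𝓝[s] t₀]
          fun _ => (1 : ℝ) := by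
        rw [isLittleO_one_iff]
        simpa using h0.continuousWithinAt.tendsto.sub_const ((R⁻¹ * C t₀ * R⁻¹) i j)
      have h2 := h0.hasFDerivWithinAt.isBigO_sub
      simpa [pow_two] using h1.mul_isBigO h2
  refine hasDerivWithinAt_of_abs_sub_le (hl1.add hl2) hφ fun t ht => ?_
  have := hb (m t - m t₀) (C t) (hpd t ht)
  rw [add_sub_cancel] at this
  convert! this using 2
  simp only [Pi.add_apply, inner_sub_right, mul_sub, Matrix.trace_sub]
  ring

theorem hasDerivWithinAt_gaussKL (hρ : IsPosDensity ρ) (hf : IsPinched (logDensity ρ) α β)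
    {m : ℝ → E n} {C : ℝ → Mat n} {m' : E n} {C' : Mat n} {s : Set ℝ} {t₀ : ℝ} (ht₀ : t₀ ∈ s)
    (hpd : ∀ t ∈ s, (C t).PosDef) (hm : HasDerivWithinAt m m' s t₀)
    (hC : ∀ i j, HasDerivWithinAt (fun t => C t i j) (C' i j) s t₀) :
    HasDerivWithinAt (fun t => (gaussKL ρ (m t) (C t)).toReal)
      (-(inner ℝ (meanScore ρ (m t₀) (C t₀)) m'
        + 1 / 2 * (covScore ρ (m t₀) (C t₀) * C').trace)) s t₀ := by
  have h1 := hasDerivWithinAt_meanLog hf ht₀ hpd hm hC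
  have h2 := hasDerivWithinAt_log_det ht₀ hpd hC
  have h3 := (h1.const_sub (-(n * Real.log (Real.sqrt (2 * Real.pi)) + n / 2))).sub
    (h2.div_const 2)
  refine (h3.congr_deriv ?_).congr (fun t ht => (gaussKL_toReal hρ hf (m t) (hpd t ht)).2)
    (gaussKL_toReal hρ hf (m t₀) (hpd t₀ ht₀)).2
  rw [covScore, add_mul, Matrix.trace_add]
  ring

end Derivative

/-! ### Existence of a minimizer and its first-order conditions. -/

section Minimizer

open Topology Filter

variable {ρ : E n → ℝ} {α β : ℝ}

/-- Squeezed between the two quadratic Taylor polynomials at `(m, L)`; singular `L` is allowed. -/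
theorem continuous_meanLog (hf : IsPinched (logDensity ρ) α β) :
    Continuous fun p : E n × Mat n => meanLog ρ p.1 p.2 := by
  rw [continuous_iff_continuousAt]
  rintro ⟨m, L⟩
  have hbound : ∀ c : ℝ, Tendsto (fun p : E n × Mat n => meanLog ρ m L
      + inner ℝ (meanScore ρ m (L * Lᵀ)) (p.1 - m)
      + ((p.2 - L)ᵀ * (meanHessian ρ m (L * Lᵀ)) * L).trace
      - c / 2 * (‖p.1 - m‖ ^ 2 + ((p.2 - L)ᵀ * (p.2 - L)).trace)) (𝓝 (m, L))
      (𝓝 (meanLog ρ m L)) := fun c => by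
    have hc : Continuous (fun p : E n × Mat n => meanLog ρ m L
      + inner ℝ (meanScore ρ m (L * Lᵀ)) (p.1 - m)
      + ((p.2 - L)ᵀ * (meanHessian ρ m (L * Lᵀ)) * L).trace
      - c / 2 * (‖p.1 - m‖ ^ 2 + ((p.2 - L)ᵀ * (p.2 - L)).trace)) := by
      have h1 : Continuous fun p : E n × Mat n => p.2 - L := by fun_prop
      have h2 := ((h1.matrix_transpose.matrix_mul
        (continuous_const (y := meanHessian ρ m (L * Lᵀ)))).matrix_mul
          (continuous_const (y := L))).matrix_trace
      have h3 := (h1.matrix_transpose.matrix_mul h1).matrix_trace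
      fun_prop
    simpa using hc.tendsto (m, L)
  refine tendsto_of_tendsto_of_tendsto_of_le_of_le (hbound β) (hbound α) (fun p => ?_) fun p => ?_
  · simpa using le_meanLog_add hf m L (p.1 - m) (p.2 - L)
  · simpa using meanLog_add_le hf m L (p.1 - m) (p.2 - L)

/-- From `log_det_le_trace_sub` for `κ L Lᵀ`. The free `κ` makes the growth of `log |det L|` an
arbitrarily small multiple of `‖L‖²`, to be beaten by strong concavity. -/
theorem log_abs_det_le {κ : ℝ} (hκ : 0 < κ) {L : Mat n} (hL : L.det ≠ 0) :
    Real.log |L.det| ≤ κ / 2 * (Lᵀ * L).trace - n / 2 * (1 + Real.log κ) := by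
  have h := log_det_le_trace_sub ((posDef_mul_transpose hL).smul hκ)
  rw [Matrix.det_smul, Matrix.det_mul, Matrix.det_transpose, Matrix.trace_smul,
    Matrix.trace_mul_comm, Fintype.card_fin, Real.log_mul (by positivity) (mul_ne_zero hL hL),
    Real.log_mul hL hL, Real.log_pow, smul_eq_mul] at h
  rw [Real.log_abs]
  linarith

/-- The exponential of `-KL[N(m, L Lᵀ) ‖ ρ]` up to a factor; continuous also at singular `L`. -/
def likelihood (ρ : E n → ℝ) (p : E n × Mat n) : ℝ :=
  |p.2.det| * Real.exp (meanLog ρ p.1 p.2)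

theorem continuous_likelihood (hf : IsPinched (logDensity ρ) α β) :
    Continuous (likelihood ρ) := by
  have h1 := continuous_meanLog hf
  have h2 : Continuous fun p : E n × Mat n => p.2.det := continuous_snd.matrix_det
  unfold likelihood
  fun_prop

theorem exists_likelihood_le (hα : 0 < α) (hf : IsPinched (logDensity ρ) α β) :
    ∃ c : ℝ, ∀ p : E n × Mat n,
      likelihood ρ p ≤ Real.exp (c - α / 4 * (‖p.1‖ ^ 2 + (p.2ᵀ * p.2).trace)) := by
  -- Expansion at `L = 0`, the Dirac mass, removes the Hessian term. Of the gain `α / 2`, half is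
  -- spent on `log |det L|` (with `κ = α / 2`) and on the term linear in `m`.
  set s := meanScore ρ 0 (0 * (0 : Mat n)ᵀ) with hs
  refine ⟨meanLog ρ 0 0 + ‖s‖ ^ 2 / α - n / 2 * (1 + Real.log (α / 2)), fun ⟨m, L⟩ => ?_⟩
  by_cases hL : L.det = 0
  · simp only [likelihood, hL, abs_zero, zero_mul]
    positivity
  have h1 := meanLog_add_le hf 0 0 m L
  rw [zero_add, zero_add, ← hs, mul_zero, Matrix.trace_zero] at h1
  have h2 := log_abs_det_le (half_pos hα) hL
  have h3 := real_inner_le_norm s m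
  have h4 : ‖s‖ * ‖m‖ ≤ ‖s‖ ^ 2 / α + α / 4 * ‖m‖ ^ 2 := by
    have : ‖s‖ ^ 2 / α + α / 4 * ‖m‖ ^ 2 - ‖s‖ * ‖m‖ = (‖s‖ - α / 2 * ‖m‖) ^ 2 / α := by
      field_simp; ring
    have h5 : 0 ≤ (‖s‖ - α / 2 * ‖m‖) ^ 2 / α := by positivity
    linarith
  rw [likelihood, ← Real.exp_log (abs_pos.2 hL), ← Real.exp_add]
  apply Real.exp_le_exp.2
  simp only
  linarith

theorem exists_likelihood_max (hα : 0 < α) (hf : IsPinched (logDensity ρ) α β) :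
    ∃ p : E n × Mat n, ∀ q, likelihood ρ q ≤ likelihood ρ p := by
  obtain ⟨c, hc⟩ := exists_likelihood_le hα hf
  refine (continuous_likelihood hf).exists_forall_ge' (0, 1) ?_
  set k := c - meanLog ρ 0 1 with hk
  -- Chosen so that outside radius `r` the bound of `exists_likelihood_le` drops below the value at
  -- `(0, 1)`.
  set r := 1 + |4 * k / α| with hr
  have hr1 : 1 ≤ r := by rw [hr]; linarith [abs_nonneg (4 * k / α)]
  have hr2 : k ≤ α / 4 * r ^ 2 := by
    have h1 : 4 * k / α ≤ r ^ 2 := by nlinarith [le_abs_self (4 * k / α)]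
    rw [div_le_iff₀ hα] at h1
    linarith
  have hcomp : IsCompact (Metric.closedBall (0 : E n) r ×ˢ
      (Set.pi univ fun _ => Set.pi univ fun _ => Icc (-r) r : Set (Mat n))) :=
    (isCompact_closedBall _ _).prod
      (isCompact_univ_pi fun _ => isCompact_univ_pi fun _ => isCompact_Icc)
  filter_upwards [hcomp.compl_mem_cocompact] with p hp
  refine (hc p).trans ?_
  have h0 : likelihood ρ ((0, 1) : E n × Mat n) = Real.exp (meanLog ρ 0 1) := by simp [likelihood]
  rw [h0]
  apply Real.exp_le_exp.2
  have h1 : r ^ 2 ≤ ‖p.1‖ ^ 2 + (p.2ᵀ * p.2).trace := by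
    by_contra! hlt
    have hn : 0 ≤ ‖p.1‖ ^ 2 := by positivity
    have ht := trace_transpose_mul_self_nonneg p.2
    refine hp ⟨?_, ?_⟩
    · rw [mem_closedBall_zero_iff]
      exact (sq_le_sq₀ (norm_nonneg _) (by linarith)).1 (by linarith)
    · intro i _ j _
      rw [mem_Icc, ← abs_le]
      refine abs_le_of_sq_le_sq ?_ (by linarith)
      rw [trace_transpose_mul_self] at hlt
      have h2 : p.2 i j ^ 2 ≤ ∑ j, p.2 i j ^ 2 :=
        Finset.single_le_sum (f := fun j => p.2 i j ^ 2) (fun j _ => by positivity)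
          (Finset.mem_univ j)
      have h3 : ∑ j, p.2 i j ^ 2 ≤ ∑ i, ∑ j, p.2 i j ^ 2 :=
        Finset.single_le_sum (f := fun i => ∑ j, p.2 i j ^ 2) (fun i _ => by positivity)
          (Finset.mem_univ i)
      linarith
  have := mul_le_mul_of_nonneg_left h1 (by positivity : 0 ≤ α / 4)
  linarith

/-- The likelihood vanishes at singular `L` and is positive at `(0, 1)`, so its maximizer is
nonsingular and defines a genuine Gaussian. -/
theorem exists_isGaussKLMinimizer (hα : 0 < α) (hρ : IsPosDensity ρ)
    (hf : IsPinched (logDensity ρ) α β) : ∃ m C, IsGaussKLMinimizer ρ m C := by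
  obtain ⟨⟨m, L⟩, hmax⟩ := exists_likelihood_max hα hf
  have hL : L.det ≠ 0 := by
    intro h
    have := hmax (0, 1)
    simp only [likelihood, h, abs_zero, zero_mul, Matrix.det_one, abs_one, one_mul] at this
    exact absurd this (not_le.2 (Real.exp_pos _))
  refine ⟨m, L * Lᵀ, posDef_mul_transpose hL, fun m' C' hC' => ?_⟩
  have hR := (posDef_sqrt hC').det_pos.ne'
  have h1 := gaussKL_mul_transpose hρ hf m hL
  have h2 := gaussKL_mul_transpose hρ hf m' hR
  rw [sqrt_mul_transpose hC'] at h2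
  rw [← ENNReal.toReal_le_toReal h1.1 h2.1, h1.2, h2.2]
  have h3 := Real.log_le_log
    (mul_pos (abs_pos.2 hR) (Real.exp_pos _)) (hmax (m', CFC.sqrt C'))
  simp only [likelihood] at h3
  rw [Real.log_mul (abs_ne_zero.2 hR) (Real.exp_ne_zero _), Real.log_exp,
    Real.log_mul (abs_ne_zero.2 hL) (Real.exp_ne_zero _), Real.log_exp] at h3
  linarith

/-- Along the curve `m + t s`, `R + t R X` with `X = R S R`, the divergence has derivative `-(‖s‖² +
tr(Xᵀ X))` at `0`, which must vanish at a minimum. -/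
theorem IsGaussKLMinimizer.critical (hρ : IsPosDensity ρ) (hf : IsPinched (logDensity ρ) α β)
    {m : E n} {C : Mat n} (h : IsGaussKLMinimizer ρ m C) :
    meanScore ρ m C = 0 ∧ covScore ρ m C = 0 := by
  obtain ⟨hC, hmin⟩ := h
  set R := CFC.sqrt C with hRdef
  set S := covScore ρ m C with hS
  set s := meanScore ρ m C with hs
  set X := R * S * R with hX
  have hR := posDef_sqrt hC
  have hRT : Rᵀ = R := transpose_of_isHermitian hR.isHermitian
  have hST : Sᵀ = S := transpose_covScore hf m hC
  have hXT : Xᵀ = X := by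
    rw [hX, Matrix.transpose_mul, Matrix.transpose_mul, hRT, hST, mul_assoc]
  set A : ℝ → Mat n := fun t => R + t • (R * X) with hA
  have hAc : Continuous fun t => (A t).det := by
    have : Continuous A := by fun_prop
    exact this.matrix_det
  have hU : IsOpen {t | (A t).det ≠ 0} := isOpen_ne_fun hAc continuous_const
  have h0 : (0 : ℝ) ∈ {t | (A t).det ≠ 0} := by
    simpa [hA] using hR.det_pos.ne'
  have hA0 : A 0 * (A 0)ᵀ = C := by simpa [hA] using sqrt_mul_transpose hC
  have hd : ∀ i j, HasDerivWithinAt (fun t => (A t * (A t)ᵀ) i j)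
      ((R * X * R + R * X * R) i j) {t | (A t).det ≠ 0} 0 := by
    intro i j
    have e : ∀ t, A t * (A t)ᵀ = R * R + t • (R * X * R + R * X * R)
        + t ^ 2 • (R * X * (X * R)) := fun t => by
      simp only [hA, Matrix.transpose_add, Matrix.transpose_smul, Matrix.transpose_mul, hRT, hXT,
        add_mul, mul_add, Matrix.smul_mul, Matrix.mul_smul, smul_smul, mul_assoc, smul_add]
      rw [pow_two]
      abel
    simp only [e, Matrix.add_apply, Matrix.smul_apply, smul_eq_mul]
    have := (((hasDerivAt_id (0 : ℝ)).mul_const ((R * X * R + R * X * R) i j)).const_add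
      ((R * R) i j)).add ((hasDerivAt_pow 2 (0 : ℝ)).mul_const ((R * X * (X * R)) i j))
    exact (this.congr_deriv (by simp)).hasDerivWithinAt
  have hm : HasDerivWithinAt (fun t : ℝ => m + t • s) s {t | (A t).det ≠ 0} 0 := by
    have := ((hasDerivAt_id (0 : ℝ)).smul_const s).const_add m
    simpa using this.hasDerivWithinAt
  have hder := (hasDerivWithinAt_gaussKL hρ hf h0
    (fun t ht => posDef_mul_transpose ht) hm hd).hasDerivAt (hU.mem_nhds h0)
  have hloc : IsLocalMin (fun t => (gaussKL ρ (m + t • s) (A t * (A t)ᵀ)).toReal) 0 := by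
    filter_upwards [hU.mem_nhds h0] with t ht
    rw [hA0, zero_smul, add_zero]
    have hpd := posDef_mul_transpose (L := A t) ht
    exact ENNReal.toReal_mono (gaussKL_toReal hρ hf _ hpd).1 (hmin _ _ hpd)
  have hz := hloc.hasDerivAt_eq_zero hder
  rw [hA0, zero_smul, add_zero, ← hs, ← hS, real_inner_self_eq_norm_sq, mul_add,
    Matrix.trace_add] at hz
  have e1 : (S * (R * X * R)).trace = (Xᵀ * X).trace := by
    rw [hXT]
    conv_rhs => rw [hX]
    rw [show R * S * R * (R * S * R) = R * (S * R * (R * S * R)) by simp only [mul_assoc],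
      Matrix.trace_mul_comm R]
    rw [← hX]; simp only [mul_assoc]
  have h2 := trace_transpose_mul_self_nonneg X
  have h3 : 0 ≤ ‖s‖ ^ 2 := by positivity
  rw [e1] at hz
  have h4 : ‖s‖ ^ 2 = 0 := by linarith
  have h5 := eq_zero_of_trace_transpose_mul_self (show (Xᵀ * X).trace = 0 by linarith)
  refine ⟨by simpa using h4, ?_⟩
  have i1 := Matrix.mul_nonsing_inv R hR.det_pos.ne'.isUnit
  have i2 := Matrix.nonsing_inv_mul R hR.det_pos.ne'.isUnit
  calc S = (R⁻¹ * R) * S * (R * R⁻¹) := by rw [i1, i2, one_mul, mul_one]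
    _ = R⁻¹ * X * R⁻¹ := by rw [hX]; simp only [mul_assoc]
    _ = 0 := by rw [h5, mul_zero, zero_mul]

end Minimizer

/-! ### A barrier principle for curves of symmetric matrices. -/

section Barrier

open Topology Filter

theorem dotProduct_self_pos {v : Fin n → ℝ} (hv : v ≠ 0) : 0 < v ⬝ᵥ v := by
  simpa using Matrix.dotProduct_star_self_pos_iff.2 hv

theorem hasDerivWithinAt_quadForm {M : ℝ → Mat n} {M' : Mat n} {s : Set ℝ} {t₀ : ℝ}
    (hM : ∀ i j, HasDerivWithinAt (fun t => M t i j) (M' i j) s t₀) (v : Fin n → ℝ) :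
    HasDerivWithinAt (fun t => v ⬝ᵥ M t *ᵥ v) (v ⬝ᵥ M' *ᵥ v) s t₀ := by
  simp only [dotProduct, Matrix.mulVec]
  exact HasDerivWithinAt.fun_sum fun i _ => (HasDerivWithinAt.fun_sum fun j _ =>
    (hM i j).mul_const _).const_mul _

/-- If a curve of symmetric matrices starts in the positive definite cone and its velocity is
positive on the kernel whenever the kernel is nontrivial, then it never leaves the cone. -/
theorem posSemidef_of_barrier {M M' : ℝ → Mat n} {T : ℝ}
    (hsym : ∀ t ∈ Icc 0 T, (M t).IsHermitian)
    (hd : ∀ t ∈ Icc 0 T, ∀ i j, HasDerivWithinAt (fun s => M s i j) (M' t i j) (Icc 0 T) t)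
    (h0 : (M 0).PosDef)
    (hc : ∀ t ∈ Icc 0 T, ∀ v ≠ 0, M t *ᵥ v = 0 → 0 < v ⬝ᵥ M' t *ᵥ v) :
    ∀ t ∈ Icc 0 T, (M t).PosSemidef := by
  set q : ℝ × (Fin n → ℝ) → ℝ := fun p => p.2 ⬝ᵥ M p.1 *ᵥ p.2 with hq
  set B : Set (ℝ × (Fin n → ℝ)) := Icc 0 T ×ˢ Metric.sphere 0 1 with hB
  have hqc : ContinuousOn q B := by
    simp only [hq, dotProduct, Matrix.mulVec]
    refine continuousOn_finsetSum _ fun i _ => ContinuousOn.mul (by fun_prop)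
      (continuousOn_finsetSum _ fun j _ => ContinuousOn.mul ?_ (by fun_prop))
    have h1 : ContinuousOn (fun t => M t i j) (Icc 0 T) :=
      fun t ht => (hd t ht i j).continuousWithinAt
    exact h1.comp continuousOn_fst fun p hp => hp.1
  have hBc : IsCompact B := isCompact_Icc.prod (isCompact_sphere _ _)
  have hSc : IsCompact (B ∩ q ⁻¹' Iic 0) :=
    hBc.of_isClosed_subset (hqc.preimage_isClosed_of_isClosed hBc.isClosed isClosed_Iic)
      inter_subset_left
  have hpos : ∀ s ∈ Icc 0 T, (∀ v ∈ Metric.sphere (0 : Fin n → ℝ) 1, 0 < q (s, v)) →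
      ∀ u ≠ 0, 0 < u ⬝ᵥ M s *ᵥ u := by
    intro s _ h u hu
    have hn : 0 < ‖u‖ := norm_pos_iff.2 hu
    have := h (‖u‖⁻¹ • u) (by simp [norm_smul, hn.ne'])
    simp only [hq, Matrix.mulVec_smul, dotProduct_smul, smul_dotProduct, smul_eq_mul] at this
    exact (mul_pos_iff_of_pos_left (by positivity)).1
      ((mul_pos_iff_of_pos_left (by positivity)).1 this)
  rcases (B ∩ q ⁻¹' Iic 0).eq_empty_or_nonempty with he | hne
  · intro t ht
    refine Matrix.PosSemidef.of_dotProduct_mulVec_nonneg (hsym t ht) fun u => ?_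
    rw [star_trivial]
    rcases eq_or_ne u 0 with rfl | hu
    · simp
    · refine (hpos t ht (fun v hv => ?_) u hu).le
      by_contra! hcon
      exact (he ▸ (⟨⟨ht, hv⟩, hcon⟩ : (t, v) ∈ B ∩ q ⁻¹' Iic 0) : (t, v) ∈ (∅ : Set _))
  exfalso
  -- By compactness there is a first time at which the form fails to be positive on some unit
  -- vector. Earlier forms are positive definite, so `M t` is semidefinite and `v` lies in its
  -- kernel.
  obtain ⟨⟨t, v⟩, ⟨⟨ht, hv⟩, hqv⟩, hmin⟩ := hSc.exists_isMinOn hne continuousOn_fst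
  simp only at ht hv
  have hqv' : v ⬝ᵥ M t *ᵥ v ≤ 0 := hqv
  have hv0 : v ≠ 0 := by
    rintro rfl
    simp at hv
  have ht0 : 0 < t := by
    rcases ht.1.eq_or_lt with h | h
    · rw [← h] at hqv'
      have := h0.dotProduct_mulVec_pos hv0
      rw [star_trivial] at this
      linarith
    · exact h
  have hbefore : ∀ s ∈ Ico 0 t, ∀ u ≠ 0, 0 < u ⬝ᵥ M s *ᵥ u := by
    intro s hs
    have hsT : s ∈ Icc 0 T := ⟨hs.1, hs.2.le.trans ht.2⟩
    refine hpos s hsT fun w hw => ?_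
    by_contra! hcon
    have := hmin (⟨⟨hsT, hw⟩, hcon⟩ : (s, w) ∈ B ∩ q ⁻¹' Iic 0)
    exact absurd this (not_le.2 hs.2)
  have hsub : Ico 0 t ⊆ Icc 0 T := fun s hs => ⟨hs.1, hs.2.le.trans ht.2⟩
  have hnebot : (𝓝[Ico 0 t] t).NeBot := by
    rw [← mem_closure_iff_nhdsWithin_neBot, closure_Ico ht0.ne]
    exact ⟨ht0.le, le_rfl⟩
  have hdv : ∀ u, HasDerivWithinAt (fun s => u ⬝ᵥ M s *ᵥ u) (u ⬝ᵥ M' t *ᵥ u) (Ico 0 t) t :=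
    fun u => (hasDerivWithinAt_quadForm (hd t ht) u).mono hsub
  have hpsd : (M t).PosSemidef := by
    refine Matrix.PosSemidef.of_dotProduct_mulVec_nonneg (hsym t ht) fun u => ?_
    rw [star_trivial]
    refine ge_of_tendsto (hdv u).continuousWithinAt.tendsto ?_
    filter_upwards [self_mem_nhdsWithin] with s hs
    rcases eq_or_ne u 0 with rfl | hu
    · simp
    · exact (hbefore s hs u hu).le
  have hzero : v ⬝ᵥ M t *ᵥ v = 0 := by
    have := hpsd.dotProduct_mulVec_nonneg v
    rw [star_trivial] at this
    exact le_antisymm hqv' this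
  have hker : M t *ᵥ v = 0 :=
    (hpsd.dotProduct_mulVec_zero_iff v).1 (by rw [star_trivial]; exact hzero)
  have hcon := hc t ht v hv0 hker
  -- The form at `v` is positive before `t` and zero at `t`: its left derivative is at most `0`,
  -- against `hcon`.
  have hslope := (hasDerivWithinAt_iff_tendsto_slope' (fun h => lt_irrefl t h.2)).1 (hdv v)
  refine absurd (le_of_tendsto hslope ?_) (not_le.2 hcon)
  filter_upwards [self_mem_nhdsWithin] with s hs
  rw [slope_def_field, hzero, sub_zero]
  exact div_nonpos_of_nonneg_of_nonpos (hbefore s hs v hv0).le (by linarith [hs.2])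

end Barrier

/-! ### Covariance bounds and dissipation along the three flows. -/

section Flows

variable {ρ : E n → ℝ} {α β : ℝ}

theorem quadForm_meanHessian_eq (hf : IsPinched (logDensity ρ) α β) (m : E n) (C : Mat n)
    (v : Fin n → ℝ) : v ⬝ᵥ meanHessian ρ m C *ᵥ v
      = ∫ θ, v ⬝ᵥ hessian (logDensity ρ) θ *ᵥ v ∂(multivariateGaussian m C) := by
  have hi := hf.integrable_hessian (multivariateGaussian m C)
  simp only [dotProduct, Matrix.mulVec, meanHessian, Matrix.of_apply]
  rw [integral_finsetSum]
  · refine Finset.sum_congr rfl fun i _ => ?_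
    rw [integral_const_mul, integral_finsetSum]
    · simp_rw [integral_mul_const]
    · exact fun j _ => (hi i j).mul_const _
  · exact fun i _ => (integrable_finsetSum _ fun j _ => (hi i j).mul_const _).const_mul _

theorem integrable_quadForm_hessian (hf : IsPinched (logDensity ρ) α β) (m : E n) (C : Mat n)
    (v : Fin n → ℝ) : Integrable (fun θ => v ⬝ᵥ hessian (logDensity ρ) θ *ᵥ v)
      (multivariateGaussian m C) := by
  have hi := hf.integrable_hessian (multivariateGaussian m C)
  simp only [dotProduct, Matrix.mulVec]
  exact integrable_finsetSum _ fun i _ =>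
    (integrable_finsetSum _ fun j _ => (hi i j).mul_const _).const_mul _

theorem quadForm_meanHessian_le (hf : IsPinched (logDensity ρ) α β) (m : E n) (C : Mat n)
    (v : Fin n → ℝ) : v ⬝ᵥ meanHessian ρ m C *ᵥ v ≤ -α * (v ⬝ᵥ v) := by
  rw [quadForm_meanHessian_eq hf]
  have := integral_mono (integrable_quadForm_hessian hf m C v) (integrable_const (-α * (v ⬝ᵥ v)))
    fun θ => by
      have := hf.le_neg θ (WithLp.toLp 2 v)
      rwa [fderiv_fderiv_eq, ← ofLp_dotProduct_self] at this
  simpa using this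

theorem le_quadForm_meanHessian (hf : IsPinched (logDensity ρ) α β) (m : E n) (C : Mat n)
    (v : Fin n → ℝ) : -β * (v ⬝ᵥ v) ≤ v ⬝ᵥ meanHessian ρ m C *ᵥ v := by
  rw [quadForm_meanHessian_eq hf]
  have := integral_mono (integrable_const (-β * (v ⬝ᵥ v))) (integrable_quadForm_hessian hf m C v)
    fun θ => by
      have := hf.neg_le θ (WithLp.toLp 2 v)
      rwa [fderiv_fderiv_eq, ← ofLp_dotProduct_self] at this
  simpa using this

theorem isHermitian_smul_one (c : ℝ) : (c • (1 : Mat n)).IsHermitian := by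
  simp [Matrix.IsHermitian]

/-- If `C v = (L + ε) v`, then `vᵀ Ċ v ≤ ½ (1 / (L + ε) - α) ‖v‖² < 0` because `L ≥ 1 / α`. The `ε`
supplies the strictness the barrier needs and is sent to `0` at the end. -/
theorem IsEuclideanFlow.cov_le (hα : 0 < α) (hf : IsPinched (logDensity ρ) α β) {lmax T : ℝ}
    {m : ℝ → E n} {C : ℝ → Mat n} (hflow : IsEuclideanFlow ρ T m C)
    (h0 : LoewnerLE (C 0) (lmax • (1 : Mat n))) :
    ∀ t ∈ Icc 0 T, (max (1 / α) lmax • (1 : Mat n) - C t).PosSemidef := by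
  set L := max (1 / α) lmax with hL
  have hLpos : 0 < L := lt_of_lt_of_le (by positivity) (le_max_left _ _)
  have hε : ∀ ε > 0, ∀ t ∈ Icc 0 T, ((L + ε) • (1 : Mat n) - C t).PosSemidef := by
    intro ε hε
    have hLe : 0 < L + ε := by positivity
    refine posSemidef_of_barrier (M' := fun t => -((1 / 2 : ℝ) • (C t)⁻¹ +
      (1 / 2 : ℝ) • meanHessian ρ (m t) (C t))) (fun t ht => ?_) (fun t ht i j => ?_) ?_
      fun t ht v hv hker => ?_
    · exact (isHermitian_smul_one _).sub (hflow.posDef t ht).isHermitian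
    · simpa using (hflow.cov t ht i j).const_sub (((L + ε) • (1 : Mat n)) i j)
    · have h1 : ((L + ε - lmax) • (1 : Mat n)).PosDef :=
        Matrix.PosDef.one.smul (by linarith [le_max_right (1 / α) lmax])
      have := h1.add_posSemidef h0
      rwa [sub_smul, sub_add_sub_cancel] at this
    · have hCv : C t *ᵥ v = (L + ε) • v := by
        rw [Matrix.sub_mulVec, Matrix.smul_mulVec, Matrix.one_mulVec, sub_eq_zero] at hker
        exact hker.symm
      have hCi : (C t)⁻¹ *ᵥ v = (L + ε)⁻¹ • v := by
        have h1 : (C t)⁻¹ *ᵥ (C t *ᵥ v) = v := by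
          rw [Matrix.mulVec_mulVec, Matrix.nonsing_inv_mul _ (hflow.posDef t ht).det_pos.ne'.isUnit,
            Matrix.one_mulVec]
        rw [hCv, Matrix.mulVec_smul] at h1
        conv_rhs => rw [← h1]
        rw [smul_smul, inv_mul_cancel₀ hLe.ne', one_smul]
      have h2 := quadForm_meanHessian_le hf (m t) (C t) v
      have hvv := dotProduct_self_pos hv
      have h3 : (L + ε)⁻¹ < α := by
        rw [inv_lt_comm₀ hLe hα, ← one_div]
        linarith [le_max_left (1 / α) lmax]
      rw [Matrix.neg_mulVec, dotProduct_neg, Matrix.add_mulVec, dotProduct_add,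
        Matrix.smul_mulVec, Matrix.smul_mulVec, dotProduct_smul, dotProduct_smul, hCi,
        dotProduct_smul, smul_eq_mul, smul_eq_mul, smul_eq_mul]
      nlinarith [mul_lt_mul_of_pos_right h3 hvv]
  intro t ht
  refine Matrix.PosSemidef.of_dotProduct_mulVec_nonneg
    ((isHermitian_smul_one _).sub (hflow.posDef t ht).isHermitian) fun v => ?_
  refine le_of_forall_pos_le_add fun δ hδ => ?_
  rcases eq_or_ne v 0 with rfl | hv
  · simpa using hδ.le
  have hvv := dotProduct_self_pos hv
  have := (hε (δ / (v ⬝ᵥ v)) (by positivity) t ht).dotProduct_mulVec_nonneg v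
  rw [add_smul, add_sub_right_comm, Matrix.add_mulVec, dotProduct_add, Matrix.smul_mulVec,
    Matrix.one_mulVec, dotProduct_smul, star_trivial, smul_eq_mul,
    div_mul_cancel₀ _ hvv.ne'] at this
  rwa [star_trivial]

/-- If `C v = (l - ε) v`, then `vᵀ Ċ v ≥ (l - ε) (1 - β (l - ε)) ‖v‖² > 0` because `l ≤ 1 / β`. -/
theorem IsFisherRaoFlow.le_cov (hf : IsPinched (logDensity ρ) α β) {lmin T : ℝ}
    {m : ℝ → E n} {C : ℝ → Mat n} (hflow : IsFisherRaoFlow ρ T m C)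
    (h0 : LoewnerLE (lmin • (1 : Mat n)) (C 0)) (hl : 0 < min (1 / β) lmin) :
    ∀ t ∈ Icc 0 T, (C t - min (1 / β) lmin • (1 : Mat n)).PosSemidef := by
  set l := min (1 / β) lmin with hldef
  have hβ : 0 < β := by
    have : 0 < 1 / β := hl.trans_le (min_le_left _ _)
    exact one_div_pos.1 this
  have hε : ∀ ε > 0, ε < l → ∀ t ∈ Icc 0 T, (C t - (l - ε) • (1 : Mat n)).PosSemidef := by
    intro ε hε hεl
    have hle : 0 < l - ε := by linarith
    refine posSemidef_of_barrier (M' := fun t => C t + C t * meanHessian ρ (m t) (C t) * C t)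
      (fun t ht => ?_) (fun t ht i j => ?_) ?_ fun t ht v hv hker => ?_
    · exact (hflow.posDef t ht).isHermitian.sub (isHermitian_smul_one _)
    · simpa using (hflow.cov t ht i j).sub_const (((l - ε) • (1 : Mat n)) i j)
    · have h1 : ((lmin - (l - ε)) • (1 : Mat n)).PosDef :=
        Matrix.PosDef.one.smul (by linarith [min_le_right (1 / β) lmin])
      have := h1.posSemidef_add h0
      rwa [sub_smul, sub_add_sub_cancel] at this
    · have hCv : C t *ᵥ v = (l - ε) • v := by
        rw [Matrix.sub_mulVec, Matrix.smul_mulVec, Matrix.one_mulVec, sub_eq_zero] at hker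
        exact hker
      have hvC : v ᵥ* C t = (l - ε) • v := by
        rw [← hCv, ← Matrix.mulVec_transpose,
          transpose_of_isHermitian (hflow.posDef t ht).isHermitian]
      have h2 := le_quadForm_meanHessian hf (m t) (C t) v
      have hvv := dotProduct_self_pos hv
      have h3 : β * (l - ε) < 1 := by
        have : l - ε < 1 / β := by linarith [min_le_left (1 / β) lmin]
        rwa [lt_div_iff₀ hβ, mul_comm] at this
      have e : v ⬝ᵥ (C t * meanHessian ρ (m t) (C t) * C t) *ᵥ v
          = (l - ε) * (l - ε) * (v ⬝ᵥ meanHessian ρ (m t) (C t) *ᵥ v) := by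
        rw [mul_assoc, ← Matrix.mulVec_mulVec, Matrix.dotProduct_mulVec, hvC,
          ← Matrix.mulVec_mulVec, hCv, Matrix.mulVec_smul, smul_dotProduct, dotProduct_smul,
          smul_eq_mul, smul_eq_mul, mul_assoc]
      rw [Matrix.add_mulVec, dotProduct_add, e, hCv, dotProduct_smul, smul_eq_mul]
      have h4 := mul_le_mul_of_nonneg_left h2 (by positivity : 0 ≤ (l - ε) * (l - ε))
      have h5 : 0 < (l - ε) * (1 - β * (l - ε)) * (v ⬝ᵥ v) := by
        have : 0 < 1 - β * (l - ε) := by linarith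
        positivity
      linarith
  intro t ht
  refine Matrix.PosSemidef.of_dotProduct_mulVec_nonneg
    ((hflow.posDef t ht).isHermitian.sub (isHermitian_smul_one _)) fun v => ?_
  refine le_of_forall_pos_le_add fun δ hδ => ?_
  rcases eq_or_ne v 0 with rfl | hv
  · simpa using hδ.le
  have hvv := dotProduct_self_pos hv
  set ε := min (δ / (v ⬝ᵥ v)) (l / 2) with hεd
  have h1 : ε * (v ⬝ᵥ v) ≤ δ := by
    rw [← le_div_iff₀ hvv]; exact min_le_left _ _
  have := (hε ε (lt_min (by positivity) (by positivity))
    (by linarith [min_le_right (δ / (v ⬝ᵥ v)) (l / 2)]) t ht).dotProduct_mulVec_nonneg v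
  rw [sub_smul, sub_sub_eq_add_sub, add_sub_right_comm, Matrix.add_mulVec, dotProduct_add,
    Matrix.smul_mulVec, Matrix.one_mulVec, dotProduct_smul, star_trivial, smul_eq_mul] at this
  rw [star_trivial]
  linarith

/-- Grönwall: `exp(K t) (F t - c)` is nonincreasing, whatever the sign of `K`. -/
theorem sub_le_exp_mul_of_deriv_le {F F' : ℝ → ℝ} {K c T : ℝ}
    (hd : ∀ t ∈ Icc 0 T, HasDerivWithinAt F (F' t) (Icc 0 T) t)
    (hle : ∀ t ∈ Icc 0 T, F' t ≤ -K * (F t - c)) :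
    ∀ t ∈ Icc 0 T, F t - c ≤ Real.exp (-K * t) * (F 0 - c) := by
  have hg : ∀ t ∈ Icc 0 T, HasDerivWithinAt (fun t => Real.exp (K * t) * (F t - c))
      (Real.exp (K * t) * (K * (F t - c) + F' t)) (Icc 0 T) t := fun t ht => by
    have h1 : HasDerivAt (fun t => Real.exp (K * t)) (Real.exp (K * t) * K) t := by
      simpa using ((hasDerivAt_id t).const_mul K).exp
    exact (h1.hasDerivWithinAt.mul ((hd t ht).sub_const c)).congr_deriv (by ring)
  have ha : AntitoneOn (fun t => Real.exp (K * t) * (F t - c)) (Icc 0 T) := by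
    refine antitoneOn_of_hasDerivWithinAt_nonpos (convex_Icc 0 T)
      (fun t ht => (hg t ht).continuousWithinAt)
      (fun t ht => (hg t (interior_subset ht)).mono interior_subset) fun t ht => ?_
    have := hle t (interior_subset ht)
    exact mul_nonpos_of_nonneg_of_nonpos (Real.exp_pos _).le (by linarith)
  intro t ht
  have h := ha (left_mem_Icc.2 (ht.1.trans ht.2)) ht ht.1
  simp only [mul_zero, Real.exp_zero, one_mul] at h
  calc F t - c = Real.exp (-K * t) * (Real.exp (K * t) * (F t - c)) := by
        rw [← mul_assoc, ← Real.exp_add]; simp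
    _ ≤ _ := by gcongr

theorem convergesWithRate_of_dissipation (hα : 0 < α) (hρ : IsPosDensity ρ)
    (hf : IsPinched (logDensity ρ) α β) {mstar : E n} {Cstar : Mat n} (hC : Cstar.PosDef)
    (hs : meanScore ρ mstar Cstar = 0) (hS : covScore ρ mstar Cstar = 0)
    {u : E n → Mat n → E n} {V : E n → Mat n → Mat n} {T K : ℝ} {m : ℝ → E n} {C : ℝ → Mat n}
    (hsol : IsSolution u V T m C)
    (hdis : ∀ t ∈ Icc 0 T,
      K * ((gaussKL ρ (m t) (C t)).toReal - (gaussKL ρ mstar Cstar).toReal)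
        ≤ inner ℝ (meanScore ρ (m t) (C t)) (u (m t) (C t))
          + 1 / 2 * (covScore ρ (m t) (C t) * V (m t) (C t)).trace) :
    ConvergesWithRate ρ α K T m C mstar Cstar := by
  have key := sub_le_exp_mul_of_deriv_le (F := fun t => (gaussKL ρ (m t) (C t)).toReal) (K := K)
    (c := (gaussKL ρ mstar Cstar).toReal)
    (fun t ht => hasDerivWithinAt_gaussKL hρ hf ht hsol.posDef (hsol.mean t ht) (hsol.cov t ht))
    (fun t ht => by have := hdis t ht; linarith)
  intro t ht
  have h := key t ht
  refine ⟨by linarith, (W2_sq_le_of_critical hα hρ hf mstar (m t) hC (hsol.posDef t ht)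
    hs hS).trans (ENNReal.ofReal_le_ofReal ?_)⟩
  have h2 := mul_le_mul_of_nonneg_left h (by positivity : 0 ≤ 2 / α)
  calc _ ≤ _ := h2
    _ = _ := by ring

theorem covScore_mul_cov (ρ : E n → ℝ) (m : E n) {C : Mat n} (hC : C.PosDef) :
    covScore ρ m C * C = meanHessian ρ m C * C + 1 := by
  rw [covScore, add_mul, Matrix.nonsing_inv_mul _ hC.det_pos.ne'.isUnit]

theorem cov_mul_covScore (ρ : E n → ℝ) (m : E n) {C : Mat n} (hC : C.PosDef) :
    C * covScore ρ m C = C * meanHessian ρ m C + 1 := by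
  rw [covScore, mul_add, Matrix.mul_nonsing_inv _ hC.det_pos.ne'.isUnit]

variable {mstar : E n} {Cstar : Mat n} {T : ℝ} {m : ℝ → E n} {C : ℝ → Mat n}

theorem IsWassersteinFlow.convergesWithRate (hα : 0 < α) (hρ : IsPosDensity ρ)
    (hf : IsPinched (logDensity ρ) α β) (hC : Cstar.PosDef)
    (hs : meanScore ρ mstar Cstar = 0) (hS : covScore ρ mstar Cstar = 0)
    (hflow : IsWassersteinFlow ρ T m C) :
    ConvergesWithRate ρ α (2 * α) T m C mstar Cstar := by
  refine convergesWithRate_of_dissipation hα hρ hf hC hs hS hflow fun t ht => ?_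
  have hCt := hflow.posDef t ht
  have pl := gaussKL_polyak_lojasiewicz hα hρ hf (m t) mstar hCt hC
  set S := covScore ρ (m t) (C t) with hSd
  -- In this form the dissipation is `‖s‖² + tr(S C S)`, the right side of `pl`, with no loss.
  have e : (2 : ℝ) • (1 : Mat n) + meanHessian ρ (m t) (C t) * C t
      + C t * meanHessian ρ (m t) (C t) = S * C t + C t * S := by
    rw [hSd, covScore_mul_cov ρ _ hCt, cov_mul_covScore ρ _ hCt, two_smul]
    abel
  rw [e, real_inner_self_eq_norm_sq, mul_add, Matrix.trace_add, ← mul_assoc, ← mul_assoc]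
  rw [mul_assoc S S, Matrix.trace_mul_comm S (S * C t)]
  linarith

theorem IsEuclideanFlow.convergesWithRate (hα : 0 < α) (hρ : IsPosDensity ρ)
    (hf : IsPinched (logDensity ρ) α β) (hC : Cstar.PosDef)
    (hs : meanScore ρ mstar Cstar = 0) (hS : covScore ρ mstar Cstar = 0) {lmax : ℝ}
    (hflow : IsEuclideanFlow ρ T m C) (h0 : LoewnerLE (C 0) (lmax • (1 : Mat n))) :
    ConvergesWithRate ρ α (2 * α / max 1 (max (4 / α) (4 * lmax))) T m C mstar Cstar := by
  refine convergesWithRate_of_dissipation hα hρ hf hC hs hS hflow fun t ht => ?_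
  have hCt := hflow.posDef t ht
  have pl := gaussKL_polyak_lojasiewicz hα hρ hf (m t) mstar hCt hC
  have hST := transpose_covScore hf (m t) hCt
  have hle := hflow.cov_le hα hf h0 t ht
  set S := covScore ρ (m t) (C t) with hSd
  -- The dissipation is `‖s‖² + ¼ tr(S²)`. The entry `1` serves the mean part; the others give `C t
  -- ≤ (D / 4) I`, hence `tr(S C S) ≤ (D / 4) tr(S²)`.
  set D := max 1 (max (4 / α) (4 * lmax)) with hD
  have hD1 : 1 ≤ D := le_max_left _ _
  have hL : max (1 / α) lmax ≤ D / 4 := by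
    refine max_le ?_ ?_
    · have : 4 / α ≤ D := (le_max_left _ _).trans (le_max_right _ _)
      have e : 1 / α = 4 / α / 4 := by ring
      rw [e]; linarith
    · have : 4 * lmax ≤ D := (le_max_right _ _).trans (le_max_right _ _)
      linarith
  have h1 := trace_conj_le (A := S) hle
  have h2 := trace_transpose_mul_self_nonneg S
  rw [Matrix.mul_smul, Matrix.smul_mul, mul_one, Matrix.trace_smul, smul_eq_mul] at h1
  have h3 := mul_le_mul_of_nonneg_right hL h2
  rw [hST] at h1 h2 h3
  have e : (1 / 2 : ℝ) • (C t)⁻¹ + (1 / 2 : ℝ) • meanHessian ρ (m t) (C t) = (1 / 2 : ℝ) • S := by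
    rw [hSd, covScore, smul_add, add_comm]
  rw [e, real_inner_self_eq_norm_sq, Matrix.mul_smul, Matrix.trace_smul, smul_eq_mul,
    div_mul_eq_mul_div, div_le_iff₀ (by linarith)]
  nlinarith [mul_le_mul_of_nonneg_right hD1 (sq_nonneg ‖meanScore ρ (m t) (C t)‖)]

theorem IsFisherRaoFlow.convergesWithRate (hα : 0 < α) (hρ : IsPosDensity ρ)
    (hf : IsPinched (logDensity ρ) α β) (hmin : IsGaussKLMinimizer ρ mstar Cstar) {lmin : ℝ}
    (hflow : IsFisherRaoFlow ρ T m C) (h0 : LoewnerLE (lmin • (1 : Mat n)) (C 0)) :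
    ConvergesWithRate ρ α (α * min (1 / β) lmin) T m C mstar Cstar := by
  obtain ⟨hs, hS⟩ := hmin.critical hρ hf
  have hC := hmin.1
  refine convergesWithRate_of_dissipation hα hρ hf hC hs hS hflow fun t ht => ?_
  have hCt := hflow.posDef t ht
  have pl := gaussKL_polyak_lojasiewicz hα hρ hf (m t) mstar hCt hC
  have hgap : 0 ≤ (gaussKL ρ (m t) (C t)).toReal - (gaussKL ρ mstar Cstar).toReal :=
    sub_nonneg.2 (ENNReal.toReal_mono (gaussKL_toReal hρ hf _ hCt).1 (hmin.2 _ _ hCt))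
  have hST := transpose_covScore hf (m t) hCt
  set S := covScore ρ (m t) (C t) with hSd
  set s := meanScore ρ (m t) (C t) with hsd
  set l := min (1 / β) lmin with hl
  set R := CFC.sqrt (C t) with hRdef
  have hRT : Rᵀ = R := transpose_of_isHermitian (posDef_sqrt hCt).isHermitian
  have hRR : R * R = C t := sqrt_mul_sqrt hCt
  have e : C t + C t * meanHessian ρ (m t) (C t) * C t = C t * S * C t := by
    rw [hSd, cov_mul_covScore ρ _ hCt, add_mul, one_mul, add_comm]
  have e1 : (S * (C t * S * C t)).trace = ((S * R)ᵀ * C t * (S * R)).trace := by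
    rw [Matrix.transpose_mul, hST, hRT]
    rw [show S * (C t * S * C t) = S * C t * S * R * R by rw [← hRR]; simp only [mul_assoc],
      Matrix.trace_mul_comm]
    simp only [mul_assoc]
  have e2 : ((S * R)ᵀ * (S * R)).trace = (S * C t * S).trace := by
    rw [Matrix.trace_mul_comm, Matrix.transpose_mul, hST, hRT, ← hRR]
    simp only [mul_assoc]
  have e3 : inner ℝ s (WithLp.toLp 2 (C t *ᵥ s.ofLp)) = s.ofLp ⬝ᵥ C t *ᵥ s.ofLp := by
    rw [← Matrix.inner_toEuclideanCLM]
    rfl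
  rw [e, e1, e3]
  -- For `l ≤ 0` the rate is not positive, and it suffices that the gap and the dissipation are
  -- nonnegative; the gap is so by minimality.
  rcases le_or_gt l 0 with hl0 | hl0
  · have h1 := hCt.posSemidef.dotProduct_mulVec_nonneg s.ofLp
    have h2 := (hCt.posSemidef.conjTranspose_mul_mul_same (S * R)).trace_nonneg
    rw [Matrix.conjTranspose_eq_transpose_of_trivial] at h2
    rw [star_trivial] at h1
    have h3 : α * l * ((gaussKL ρ (m t) (C t)).toReal - (gaussKL ρ mstar Cstar).toReal) ≤ 0 :=
      mul_nonpos_of_nonpos_of_nonneg (mul_nonpos_of_nonneg_of_nonpos hα.le hl0) hgap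
    linarith
  -- Here `C t ≥ l I` bounds the dissipation below by `l (‖s‖² + ½ tr(S C S))`. The factor `½` on
  -- the covariance part is why the rate is `α l` and not `2 α l`.
  · have hle := hflow.le_cov hf h0 hl0 t ht
    have h1 := trace_conj_le (A := S * R) hle
    rw [Matrix.mul_smul, Matrix.smul_mul, mul_one, Matrix.trace_smul, smul_eq_mul, e2] at h1
    have h2 := hle.dotProduct_mulVec_nonneg s.ofLp
    rw [Matrix.sub_mulVec, dotProduct_sub, Matrix.smul_mulVec, Matrix.one_mulVec,
      dotProduct_smul, star_trivial, smul_eq_mul, ofLp_dotProduct_self] at h2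
    have h3 := mul_le_mul_of_nonneg_left pl hl0.le
    have h4 : 0 ≤ l * ‖s‖ ^ 2 := by positivity
    nlinarith

end Flows

end

end GaussianVI

/-! ### The convergence theorem. -/

theorem proposition4p12 {n : ℕ} (ρ : GaussianVI.E n → ℝ) (α β : ℝ) (hα : 0 < α)
    (hρ : GaussianVI.IsPosDensity ρ)
    (hlc : GaussianVI.StronglyLogConcave α ρ)
    (hβ : ∀ θ, GaussianVI.LoewnerLE (-GaussianVI.hessian (GaussianVI.logDensity ρ) θ)
      (β • (1 : GaussianVI.Mat n))) :
    -- all the divergences involved are finite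
    (∀ (m : GaussianVI.E n) (C : GaussianVI.Mat n), C.PosDef → GaussianVI.gaussKL ρ m C ≠ ∞) ∧
    -- there is a unique Gaussian minimizer, and the flows converge to it
    ∃ (mstar : GaussianVI.E n) (Cstar : GaussianVI.Mat n),
      GaussianVI.IsGaussKLMinimizer ρ mstar Cstar ∧
      (∀ m C, GaussianVI.IsGaussKLMinimizer ρ m C → m = mstar ∧ C = Cstar) ∧
      ∀ (lmin lmax T : ℝ) (m : ℝ → GaussianVI.E n) (C : ℝ → GaussianVI.Mat n),
        GaussianVI.LoewnerLE (lmin • (1 : GaussianVI.Mat n)) (C 0) →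
        GaussianVI.LoewnerLE (C 0) (lmax • (1 : GaussianVI.Mat n)) →
        (GaussianVI.IsEuclideanFlow ρ T m C →
          GaussianVI.ConvergesWithRate ρ α (2 * α / max 1 (max (4 / α) (4 * lmax)))
            T m C mstar Cstar) ∧
        (GaussianVI.IsFisherRaoFlow ρ T m C →
          GaussianVI.ConvergesWithRate ρ α (α * min (1 / β) lmin) T m C mstar Cstar) ∧
        (GaussianVI.IsWassersteinFlow ρ T m C →
          GaussianVI.ConvergesWithRate ρ α (2 * α) T m C mstar Cstar) := by
  have hf := GaussianVI.isPinched_of_loewnerLE hlc.1 hlc.2 hβ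
  refine ⟨fun m C hC => (GaussianVI.gaussKL_toReal hρ hf m hC).1, ?_⟩
  obtain ⟨mstar, Cstar, hmin⟩ := GaussianVI.exists_isGaussKLMinimizer hα hρ hf
  obtain ⟨hs, hS⟩ := hmin.critical hρ hf
  refine ⟨mstar, Cstar, hmin, fun m C h => ?_, fun lmin lmax T m C h0 h1 => ⟨fun h => ?_,
    fun h => ?_, fun h => ?_⟩⟩
  · exact GaussianVI.gaussKL_minimizer_of_critical hα hρ hf mstar m hmin.1 h.1 hs hS
      (ENNReal.toReal_mono (GaussianVI.gaussKL_toReal hρ hf _ hmin.1).1 (h.2 _ _ hmin.1))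
  · exact h.convergesWithRate hα hρ hf hmin.1 hs hS h1
  · exact h.convergesWithRate hα hρ hf hmin h0
  · exact h.convergesWithRate hα hρ hf hmin.1 hs hS
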